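/- **Setting.** Let $n=(n_1,n_2)$, $m=(m_1,m_2)$ be pairs of nonnegative integers with $n_1+n_2=m_1+m_2$, and let $\lambda=(\lambda_1,\lambda_2)$, $z=(z_1,z_2)\in\mathbb C^2$ each have distinct coordinates. Let $p_1,p_2\in\mathbb C[x]$ have degrees $n_1,n_2$ and put $V=\langle p_1(x)e^{\lambda_1x},p_2(x)e^{\lambda_2x}\rangle$. Assume that $(V,z)$ is a *space of the $(\lambda,z,n,m)$-type*: for $a=1,2$ the set of orders of vanishing at $z_a$ of nonzero elements of $V$ is $\{0,1+m_a\}$, and at every other point of $\mathbb C$ it is $\{0,1\}$. Let $V^\star$ be the span of the functions $f/\mathrm{Wr}_V$, $f\in V$, where $\mathrm{Wr}_V$ is the Wronskian of a basis of $V$, and let $U$ be the *special bispectral dual* of $V$, the span of the functions $$u\mapsto\oint_{\gamma_a}\frac{e^{ux}f(x)}{(x-z_1)(x-z_2)}\,dx,\qquad f\in V^\star,\ a=1,2,$$ where $\gamma_a$ is a small circle around $z_a$. Write $U=\langle q_1(u)e^{z_1u},q_2(u)e^{z_2u}\rangle$ with polynomials $q_1,q_2$ of degrees $m_1,m_2$.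 Define $c_i,d_i,e_i$ by $$p_2(x)=\sum_{i=0}^{n_2}c_i\frac{(x-z_1)^{n_2-i}}{(n_2-i)!}\frac{(x-z_2)^i}{i!},\qquad p_1(x)=\sum_{i=0}^{n_1}d_i\frac{(x-z_1)^{n_1-i}}{(n_1-i)!}\frac{(x-z_2)^i}{i!},$$ $$q_2(u)=\sum_{i=0}^{m_2}e_i\frac{(u-\lambda_1)^{m_2-i}}{(m_2-i)!}\frac{(u-\lambda_2)^i}{i!}.$$ Let $\mathfrak{gl}_2$ act on $\mathbb C[x_1,x_2]$ by $E_{ij}\mapsto x_i\,\partial/\partial x_j$, let $L_k$ be the irreducible submodule of homogeneous polynomials of degree $k$, $v_k=x_1^k$, and let $(L_{m_1}\otimes L_{m_2})[n_1,n_2]$ be the subspace of $L_{m_1}\otimes L_{m_2}$ on which $E_{ii}$ acts as $n_i$, $i=1,2$. The *Weyl isomorphism* $W:(L_{m_1}\otimes L_{m_2})[n_1,n_2]\to(L_{m_1}\otimes L_{m_2})[n_2,n_1]$ is $$\frac{E_{21}^{n_2-i}v_{m_1}}{(n_2-i)!}\otimes\frac{E_{21}^iv_{m_2}}{i!}\mapsto\frac{E_{21}^{m_1-n_2+i}v_{m_1}}{(m_1-n_2+i)!}\otimes\frac{E_{21}^{m_2-i}v_{m_2}}{(m_2-i)!};$$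 it is induced by $x_1\leftrightarrow x_2$ in both factors. The *duality isomorphism* $\Delta:(L_{n_1}\otimes L_{n_2})[m_1,m_2]\to(L_{m_1}\otimes L_{m_2})[n_1,n_2]$ is induced by the isomorphisms of $\mathbb C[x_1,x_2]^{\otimes2}$ with $\mathbb C[x_{11},x_{12},x_{21},x_{22}]$ given by $g_1\otimes g_2\mapsto g_1(x_{11},x_{21})\,g_2(x_{12},x_{22})$ on the source and by $g_1\otimes g_2\mapsto g_1(x_{11},x_{12})\,g_2(x_{21},x_{22})$ on the target. For $M=(M_1,M_2)$, $k\ge0$ and a sequence $a=(a_i)$ put $$B_{M,k}(a)=\sum_{i=\max(0,k-M_1)}^{\min(M_2,k)}a_i\,\frac{E_{21}^{k-i}v_{M_1}}{(k-i)!}\otimes\frac{E_{21}^iv_{M_2}}{i!}\in L_{M_1}\otimes L_{M_2}.$$ For $\mu\in\mathbb C^2$, $y\in\mathbb C^2$ with distinct coordinates and $t\in\mathbb C^k$, let $$\Phi(t;\mu;y;M)=e^{\mu_1(M_1y_1+M_2y_2)+(\mu_2-\mu_1)\sum_jt_j}(y_1-y_2)^{M_1M_2}\prod_{j}(t_j-y_1)^{-M_1}(t_j-y_2)^{-M_2}\prod_{j<j'}(t_j-t_{j'})^2$$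 be the master function. Call $t$ *admissible* (for $y$) if its coordinates are distinct and different from $y_1,y_2$. The universal rational function is $$\omega_{y,M}(t)=B_{M,k}\big(C(t)\big),\qquad C_i(t)=\sum_{\sigma\in\Sigma_k}\ \prod_{j=1}^{k-i}\frac1{t_{\sigma(j)}-y_1}\ \prod_{j=k-i+1}^{k}\frac1{t_{\sigma(j)}-y_2};$$ when $t$ is an admissible critical point of $\Phi(\,\cdot\,;\mu;y;M)$ it is called a *Bethe vector*. **Statement.** 1. $W$ and $\Delta$ map the stated weight subspaces isomorphically onto each other, and $$B_{m,n_2}(c)\in(L_{m_1}\otimes L_{m_2})[n_1,n_2],\quad B_{m,n_1}(d)\in(L_{m_1}\otimes L_{m_2})[n_2,n_1],\quad B_{n,m_2}(e)\in(L_{n_1}\otimes L_{n_2})[m_1,m_2].$$ 2. These three vectors are identified, up to scalar factors, by $W$ and $\Delta$: there are a nonzero $w\in(L_{m_1}\otimes L_{m_2})[n_1,n_2]$ and $\kappa_1,\kappa_2,\kappa_3\in\mathbb C$ with $$B_{m,n_2}(c)=\kappa_1w,\qquad B_{m,n_1}(d)=\kappa_2\,W(w),\qquad \Delta\big(B_{n,m_2}(e)\big)=\kappa_3w.$$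 Moreover $\kappa_1\ne0$ if $p_2$ does not vanish at $z_1,z_2$; $\kappa_2\neq0$ if $p_1$ does not vanish at $z_1,z_2$; and $\kappa_3\ne0$ if $q_2$ does not vanish at $\lambda_1,\lambda_2$. 3. If the roots of $p_2$, listed as $t\in\mathbb C^{n_2}$, are admissible for $z$, then $t$ is a critical point of $\Phi(\,\cdot\,;\lambda_1,\lambda_2;z;m)$, and the Bethe vector $\omega_{z,m}(t)$ is nonzero and is a nonzero multiple of $B_{m,n_2}\big(((-1)^ic_i)_i\big)$. If the roots $s\in\mathbb C^{n_1}$ of $p_1$ are admissible for $z$, then $s$ is a critical point of $\Phi(\,\cdot\,;\lambda_2,\lambda_1;z;m)$, and $\omega_{z,m}(s)$ is nonzero and is a nonzero multiple of $B_{m,n_1}\big(((-1)^id_i)_i\big)$. If the roots $r\in\mathbb C^{m_2}$ of $q_2$ are admissible for $\lambda$, then $r$ is a critical point of $\Phi(\,\cdot\,;z;\lambda;n)$, and $\omega_{\lambda,n}(r)$ is nonzero and is a nonzero multiple of $B_{n,m_2}\big(((-1)^ie_i)_i\big)$. 4. The Bethe vectors are identified up to proportionality: $W(\omega_{z,m}(t))$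 is a nonzero multiple of $\omega_{z,m}(s)$ whenever $t$ and $s$ are admissible, and $\Delta(\omega_{\lambda,n}(r))$ is a nonzero multiple of $\omega_{z,m}(t)$ whenever $t$ and $r$ are admissible. -/

import Mathlib

open Polynomial
open scoped TensorProduct

noncomputable section

/-! ### Spaces of functions -/

/-- The set of exponents of a space `V` of entire functions at the point `w`:
the orders at `w` of the nonzero elements of `V` (an identically zero germ has order `⊤`
and contributes nothing). -/
def exponents (V : Submodule ℂ (ℂ → ℂ)) (w : ℂ) : Set ℕ :=
  {e | ∃ f ∈ V, analyticOrderAt f w = (e : ℕ∞)}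

/-- The quasi-polynomial `x ↦ p(x) e^{μ x}`. -/
def quasiPoly (p : ℂ[X]) (μ : ℂ) : ℂ → ℂ := fun x => p.eval x * Complex.exp (μ * x)

/-- The space spanned by `p_i(x) e^{l_i x}`. -/
def quasiSpace {N : ℕ} (l : Fin N → ℂ) (p : Fin N → ℂ[X]) : Submodule ℂ (ℂ → ℂ) :=
  Submodule.span ℂ (Set.range fun i => quasiPoly (p i) (l i))

/-- `(V, z)` is a space of the `(l, z, n, m)`-type (a special space), for `N, M > 1`:
`V` is spanned by `p_i(x) e^{l_i x}` with `deg p_i = n_i`; the distinct points `z_a` contain all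
singular points of `V` (points whose set of exponents differs from `{0, …, N-1}`); and the set of
exponents of `V` at `z_a` is `{0, …, N-2, N-1+m_a}`. -/
structure IsSpecialSpace {N M : ℕ} (l : Fin N → ℂ) (z : Fin M → ℂ) (n : Fin N → ℕ)
    (m : Fin M → ℕ) (V : Submodule ℂ (ℂ → ℂ)) : Prop where
  one_lt_N : 1 < N
  one_lt_M : 1 < M
  l_injective : Function.Injective l
  z_injective : Function.Injective z
  exists_basis : ∃ p : Fin N → ℂ[X], (∀ i, (p i).degree = (n i : WithBot ℕ)) ∧ V = quasiSpace l p
  exponents_regular : ∀ w, w ∉ Set.range z → exponents V w = {e | e < N}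
  exponents_z : ∀ a, exponents V (z a) = {e | e < N - 1} ∪ {N - 1 + m a}

/-- The Wronskian of `f_1, …, f_k`. -/
def functionWronskian {k : ℕ} (f : Fin k → ℂ → ℂ) (x : ℂ) : ℂ :=
  (Matrix.of fun i j : Fin k => iteratedDeriv (j : ℕ) (f i) x).det

/-- The conjugate space `V^⋆` of an `N`-dimensional space `V`: the span of all
`Wr(f_1, …, f_{N-1}) / Wr_V` with `f_i ∈ V`, where `Wr_V` is the Wronskian of a basis of `V`. -/
def conjugateSpace (N : ℕ) (V : Submodule ℂ (ℂ → ℂ)) : Submodule ℂ (ℂ → ℂ) :=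
  Submodule.span ℂ {g | ∃ b : Fin N → ℂ → ℂ, LinearIndependent ℂ b ∧
    Submodule.span ℂ (Set.range b) = V ∧
    ∃ f : Fin (N - 1) → ℂ → ℂ, (∀ i, f i ∈ V) ∧ g = fun x => functionWronskian f x / functionWronskian b x}

/-- The special bispectral dual of an `N`-dimensional special space `(V, z)`: the span of all
`u ↦ ∮_{γ_a} e^{ux} f(x) ∏_b (x - z_b)⁻¹ dx`, where `f ∈ V^⋆` and `γ_a` is a small circle around
`z_a` (that is: of any sufficiently small radius `r > 0`). -/
def specialDual (N : ℕ) {M : ℕ} (z : Fin M → ℂ) (V : Submodule ℂ (ℂ → ℂ)) :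
    Submodule ℂ (ℂ → ℂ) :=
  Submodule.span ℂ {g | ∃ a : Fin M, ∃ f ∈ conjugateSpace N V,
    ∀ᶠ r : ℝ in nhdsWithin 0 (Set.Ioi 0), ∀ u : ℂ,
      g u = ∮ x in C(z a, r), Complex.exp (u * x) * f x * ∏ b, (x - z b)⁻¹}

/-- The polynomial `∑_{i=0}^k c_i (x - z_1)^{k-i}/(k-i)! (x - z_2)^i/i!`. -/
def twoPointPoly (z : Fin 2 → ℂ) (k : ℕ) (c : ℕ → ℂ) : ℂ[X] :=
  ∑ i ∈ Finset.range (k + 1),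
    C (c i / ((k - i).factorial * i.factorial)) * ((X - C (z 0)) ^ (k - i) * (X - C (z 1)) ^ i)

/-! ### Representations of `gl_2` on polynomials and the dualities -/

/-- `ℂ[x_1, x_2]`; the variable `x_1` is `X 0` and `x_2` is `X 1`. -/
abbrev Pol : Type := MvPolynomial (Fin 2) ℂ

/-- The generator `E_{ij}` of `gl_2` acting on `ℂ[x_1, x_2]` by `x_i ∂/∂x_j`. -/
def polE (i j : Fin 2) : Module.End ℂ Pol :=
  (LinearMap.mulLeft ℂ (MvPolynomial.X i : Pol)) ∘ₗ (MvPolynomial.pderiv j).toLinearMap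

/-- The irreducible `gl_2`-module `L_k` of highest weight `(k, 0)`: homogeneous polynomials of
degree `k`, with highest weight vector `v_k = x_1^k`. -/
def irrep (k : ℕ) : Submodule ℂ Pol := MvPolynomial.homogeneousSubmodule (Fin 2) ℂ k

/-- `E_{21}^j v_k / j!` in `L_k`. -/
def lowered (k j : ℕ) : Pol :=
  ((j.factorial : ℂ)⁻¹) • ((polE 1 0) ^ j) ((MvPolynomial.X 0 : Pol) ^ k)

/-- `E_{ij}` acting on the tensor product `ℂ[x_1, x_2] ⊗ ℂ[x_1, x_2]`. -/
def tensorE (i j : Fin 2) : Module.End ℂ (Pol ⊗[ℂ] Pol) :=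
  TensorProduct.map (polE i j) LinearMap.id + TensorProduct.map LinearMap.id (polE i j)

/-- The weight subspace `(L_{m_1} ⊗ L_{m_2})[n_1, n_2]`, inside `ℂ[x_1, x_2] ⊗ ℂ[x_1, x_2]`. -/
def weightSpace (m n : Fin 2 → ℕ) : Submodule ℂ (Pol ⊗[ℂ] Pol) :=
  LinearMap.range (TensorProduct.map (irrep (m 0)).subtype (irrep (m 1)).subtype) ⊓
    ⨅ i, Module.End.eigenspace (tensorE i i) (n i : ℂ)

/-- The isomorphism `ℂ[x_1, x_2]^{⊗ 2} → ℂ[x_{ai}]`,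
`p_1 ⊗ p_2 ↦ p_1(x_{11}, x_{12}) p_2(x_{21}, x_{22})`; the variable `x_{ai}` is `X (a, i)`. -/
def rowIso : (Pol ⊗[ℂ] Pol) ≃ₗ[ℂ] MvPolynomial (Fin 2 × Fin 2) ℂ :=
  ((MvPolynomial.tensorEquivSum ℂ (Fin 2) (Fin 2) ℂ).trans
    (MvPolynomial.renameEquiv ℂ ((Equiv.boolProdEquivSum (Fin 2)).symm.trans
      (Equiv.prodCongr finTwoEquiv.symm (Equiv.refl _))))).toLinearEquiv

/-- The isomorphism `ℂ[x_1, x_2]^{⊗ 2} → ℂ[x_{ai}]`,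
`p_1 ⊗ p_2 ↦ p_1(x_{11}, x_{21}) p_2(x_{12}, x_{22})`. -/
def colIso : (Pol ⊗[ℂ] Pol) ≃ₗ[ℂ] MvPolynomial (Fin 2 × Fin 2) ℂ :=
  rowIso.trans (MvPolynomial.renameEquiv ℂ (Equiv.prodComm (Fin 2) (Fin 2))).toLinearEquiv

theorem rowIso_tmul (p q : Pol) : rowIso (p ⊗ₜ[ℂ] q) =
    MvPolynomial.rename (fun i => ((0 : Fin 2), i)) p *
      MvPolynomial.rename (fun i => ((1 : Fin 2), i)) q := by
  have h : ∀ x : Pol ⊗[ℂ] Pol, rowIso x =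
      ((MvPolynomial.renameEquiv ℂ ((Equiv.boolProdEquivSum (Fin 2)).symm.trans
        (Equiv.prodCongr finTwoEquiv.symm (Equiv.refl _)))).toAlgHom.comp
        (MvPolynomial.tensorEquivSum ℂ (Fin 2) (Fin 2) ℂ).toAlgHom) x := fun _ => rfl
  have e : (MvPolynomial.renameEquiv ℂ ((Equiv.boolProdEquivSum (Fin 2)).symm.trans
        (Equiv.prodCongr finTwoEquiv.symm (Equiv.refl _)))).toAlgHom.comp
        (MvPolynomial.tensorEquivSum ℂ (Fin 2) (Fin 2) ℂ).toAlgHom =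
      Algebra.TensorProduct.lift
        (MvPolynomial.rename (fun i => ((0 : Fin 2), i)) : Pol →ₐ[ℂ] _)
        (MvPolynomial.rename (fun i => ((1 : Fin 2), i)) : Pol →ₐ[ℂ] _)
        (fun _ _ => Commute.all _ _) := by
    apply Algebra.TensorProduct.ext
    · ext i
      simp [finTwoEquiv]
    · ext i
      simp [finTwoEquiv]
  rw [h, e]
  simp

theorem colIso_tmul (p q : Pol) : colIso (p ⊗ₜ[ℂ] q) =
    MvPolynomial.rename (fun a => (a, (0 : Fin 2))) p *
      MvPolynomial.rename (fun a => (a, (1 : Fin 2))) q := by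
  simp only [colIso, LinearEquiv.trans_apply, rowIso_tmul]
  simp [MvPolynomial.rename_rename, Function.comp_def]

/-- The `(gl_2, gl_2)` duality isomorphism; it restricts to `L_n[m] ≃ L_m[n]`. -/
def dualityIso : (Pol ⊗[ℂ] Pol) ≃ₗ[ℂ] (Pol ⊗[ℂ] Pol) := colIso.trans rowIso.symm

/-- The Weyl isomorphism; it interchanges `x_1` and `x_2` in both tensor factors and restricts to
`(L_{m_1} ⊗ L_{m_2})[n_1, n_2] ≃ (L_{m_1} ⊗ L_{m_2})[n_2, n_1]`. -/
def weylIso : (Pol ⊗[ℂ] Pol) ≃ₗ[ℂ] (Pol ⊗[ℂ] Pol) :=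
  TensorProduct.congr
    (MvPolynomial.renameEquiv ℂ (Equiv.swap (0 : Fin 2) 1)).toLinearEquiv
    (MvPolynomial.renameEquiv ℂ (Equiv.swap (0 : Fin 2) 1)).toLinearEquiv

theorem lowered_eq {k j : ℕ} (h : j ≤ k) : lowered k j =
    (k.choose j : ℂ) • ((MvPolynomial.X 0 : Pol) ^ (k - j) * MvPolynomial.X 1 ^ j) := by
  have key : ∀ j ≤ k, ((polE 1 0) ^ j) ((MvPolynomial.X 0 : Pol) ^ k) =
      (k.descFactorial j : ℂ) • ((MvPolynomial.X 0 : Pol) ^ (k - j) * MvPolynomial.X 1 ^ j) := by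
    intro j
    induction j with
    | zero => intro _; simp
    | succ j ih =>
      intro hj
      obtain ⟨d, rfl⟩ : ∃ d, k = j + 1 + d := ⟨k - (j + 1), by omega⟩
      rw [pow_succ', Module.End.mul_apply, ih (by omega), map_smul]
      have h1 : j + 1 + d - j = d + 1 := by omega
      have h2 : j + 1 + d - (j + 1) = d := by omega
      rw [h1, h2, Nat.descFactorial_succ, h1]
      simp [polE, Derivation.leibniz, Derivation.leibniz_pow, MvPolynomial.smul_eq_C_mul]
      ring
  rw [lowered, key j h, smul_smul, Nat.descFactorial_eq_factorial_mul_choose]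
  congr 1
  have : (j.factorial : ℂ) ≠ 0 := Nat.cast_ne_zero.mpr j.factorial_ne_zero
  push_cast
  field_simp

/-- The defining formula of the Weyl isomorphism on the standard basis. -/
theorem weylIso_formula {m₁ m₂ k i : ℕ} (h₁ : k - i ≤ m₁) (h₂ : i ≤ m₂) (h₃ : i ≤ k) :
    weylIso (lowered m₁ (k - i) ⊗ₜ[ℂ] lowered m₂ i) =
      lowered m₁ (m₁ + i - k) ⊗ₜ[ℂ] lowered m₂ (m₂ - i) := by
  have key : ∀ {k j : ℕ}, j ≤ k →
      MvPolynomial.rename (Equiv.swap (0 : Fin 2) 1) (lowered k j) = lowered k (k - j) := by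
    intro k j h
    rw [lowered_eq h, lowered_eq (Nat.sub_le k j), Nat.choose_symm h, Nat.sub_sub_self h]
    simp [mul_comm]
  have h : m₁ + i - k = m₁ - (k - i) := by omega
  rw [h, ← key h₁, ← key h₂]
  rfl

/-- The vector `∑_i c_i E_{21}^{k-i} v_{m_1}/(k-i)! ⊗ E_{21}^i v_{m_2}/i!` in `L_{m_1} ⊗ L_{m_2}`,
the sum being over `max(0, k - m_1) ≤ i ≤ min(m_2, k)` (truncated subtraction is meant; for all
other `0 ≤ i ≤ k` one of the two tensor factors is zero). -/
def betheSum (m : Fin 2 → ℕ) (k : ℕ) (c : ℕ → ℂ) : Pol ⊗[ℂ] Pol :=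
  ∑ i ∈ Finset.Icc (k - m 0) (min (m 1) k), c i • (lowered (m 0) (k - i) ⊗ₜ[ℂ] lowered (m 1) i)

/-! ### Master functions and Bethe vectors for `N = M = 2` -/

/-- The master function `Φ(t_1, …, t_k; l; z; m)`. -/
def masterFunction (l z : Fin 2 → ℂ) (m : Fin 2 → ℕ) {k : ℕ} (t : Fin k → ℂ) : ℂ :=
  Complex.exp (l 0 * (m 0 * z 0 + m 1 * z 1) + (l 1 - l 0) * ∑ j, t j) *
    (z 0 - z 1) ^ (m 0 * m 1) *
    (∏ j, ((t j - z 0) ^ m 0)⁻¹ * ((t j - z 1) ^ m 1)⁻¹) *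
    ∏ j, ∏ j' ∈ Finset.univ.filter (fun j' => j < j'), (t j - t j') ^ 2

/-- Admissible points: distinct coordinates, none of them equal to `z_1` or `z_2`. -/
def IsAdmissible (z : Fin 2 → ℂ) {k : ℕ} (t : Fin k → ℂ) : Prop :=
  Function.Injective t ∧ ∀ j a, t j ≠ z a

/-- `t` is a critical point of the master function: all partial derivatives vanish at `t`. -/
def IsCriticalPoint (l z : Fin 2 → ℂ) (m : Fin 2 → ℕ) {k : ℕ} (t : Fin k → ℂ) : Prop :=
  ∀ j, HasDerivAt (fun s => masterFunction l z m (Function.update t j s)) 0 (t j)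

/-- The polynomial `p`, considered up to a nonzero factor, represents the orbit of `t`. -/
def Represents (p : ℂ[X]) {k : ℕ} (t : Fin k → ℂ) : Prop :=
  ∃ a : ℂ, a ≠ 0 ∧ p = C a * ∏ j, (X - C (t j))

/-- `C_i(t) = Sym ∏_{j=1}^{k-i} 1/(t_j - z_1) ∏_{j=1}^{i} 1/(t_{k-i+j} - z_2)`. -/
def betheCoeff (z : Fin 2 → ℂ) {k : ℕ} (t : Fin k → ℂ) (i : ℕ) : ℂ :=
  ∑ σ : Equiv.Perm (Fin k), ∏ j : Fin k,
    if (j : ℕ) < k - i then (t (σ j) - z 0)⁻¹ else (t (σ j) - z 1)⁻¹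

/-- The universal rational function `ω(t)`, with values in `L_{m_1} ⊗ L_{m_2}`. -/
def universalVector (z : Fin 2 → ℂ) (m : Fin 2 → ℕ) {k : ℕ} (t : Fin k → ℂ) : Pol ⊗[ℂ] Pol :=
  betheSum m k (betheCoeff z t)

/-- The pair `(a_2, a_1)`. -/
def swapPair {α : Type} (a : Fin 2 → α) : Fin 2 → α := a ∘ Equiv.swap 0 1

end

/-!
Put `S = (x - z₁) (x - z₂)`, `T = m₁ (x - z₂) + m₂ (x - z₁)` and `δ = l₂ - l₁`. The exponents of
`V` force the second order operator annihilating `V` to be obtained, for some constant `E`, from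
the kernel
`(u - l₁) (u - l₂) S - (u - l₂) T - δ n₂ (x - z₂) - E`
by substituting `d/dx` for `u`. Integration by parts in the contour integrals shows that the same
kernel, with `d/du` substituted for `x`, annihilates the dual space `U`. As `n₁ + n₂ = m₁ + m₂`,
exchanging `x` with `u` in the kernel amounts to exchanging `(l, n)` with `(z, m)`. Hence `p₂`, `p₁`
and `q₂` all solve confluent Heun equations with the same accessory parameter `E`, and, up to
reversal of the index, their two-point coefficients solve one three-term recurrence. On the block
of indices that survive in `L_{m₁} ⊗ L_{m₂}` its outer entries do not vanish, so its solutions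
there form a line, which contains the three vectors.

The critical point equations are the Heun equation evaluated at the roots, and the universal vector
of the roots of a polynomial is read off the two-point coefficients through symmetric functions of
`1 / (t - y₁)` and `1 / (t - y₂)`.
-/

/-! ### The Heun operator -/

/-- The polynomial `(X - y₁)(X - y₂)` whose roots are the two finite singular points. -/
noncomputable def nodePoly (y : Fin 2 → ℂ) : ℂ[X] := (X - C (y 0)) * (X - C (y 1))

/-- The polynomial `(X - y₁) ^ M₁ (X - y₂) ^ M₂`, to which the Wronskian of a special space is
proportional. -/
noncomputable def nodePowPoly (y : Fin 2 → ℂ) (M : Fin 2 → ℕ) : ℂ[X] :=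
  (X - C (y 0)) ^ M 0 * (X - C (y 1)) ^ M 1

/-- The polynomial `P` with `P / nodePoly y` the logarithmic derivative of `nodePowPoly y M`. -/
noncomputable def polarPoly (y : Fin 2 → ℂ) (M : Fin 2 → ℕ) : ℂ[X] :=
  C (M 0 : ℂ) * (X - C (y 1)) + C (M 1 : ℂ) * (X - C (y 0))

theorem nodePoly_mul_derivative_nodePowPoly (y : Fin 2 → ℂ) (M : Fin 2 → ℕ) :
    nodePoly y * derivative (nodePowPoly y M) = polarPoly y M * nodePowPoly y M := by
  have h (a : ℂ) (j : ℕ) : (X - C a) * derivative ((X - C a) ^ j) = C (j : ℂ) * (X - C a) ^ j := by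
    cases j with
    | zero => simp
    | succ j => rw [derivative_X_sub_C_pow, Nat.add_sub_cancel]; ring
  rw [nodePowPoly, derivative_mul, nodePoly, polarPoly]
  linear_combination (X - C (y 1)) * (X - C (y 1)) ^ M 1 * h (y 0) (M 0) +
    (X - C (y 0)) * (X - C (y 0)) ^ M 0 * h (y 1) (M 1)

theorem eval_nodePoly_ne_zero {y : Fin 2 → ℂ} {x : ℂ} (hx : ∀ a, x ≠ y a) :
    (nodePoly y).eval x ≠ 0 := by
  simp [nodePoly, sub_ne_zero, hx]

theorem eval_nodePowPoly_ne_zero {y : Fin 2 → ℂ} {x : ℂ} (hx : ∀ a, x ≠ y a) (M : Fin 2 → ℕ) :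
    (nodePowPoly y M).eval x ≠ 0 := by
  simp [nodePowPoly, sub_ne_zero, hx]

/-- The differential operator
`(x - y₁)(x - y₂)(∂² + δ ∂) - (M₁ (x - y₂) + M₂ (x - y₁)) ∂ - δ k (x - y₂)`. Its eigenvectors are
the polynomial solutions of a confluent Heun equation, the eigenvalue being the accessory
parameter; the last term is normalised so that polynomials of degree at most `k` are preserved. -/
noncomputable def heunOp (y : Fin 2 → ℂ) (M : Fin 2 → ℕ) (δ : ℂ) (k : ℕ) : Module.End ℂ ℂ[X] :=
  LinearMap.mulLeft ℂ (nodePoly y) ∘ₗ (derivative ∘ₗ derivative + δ • derivative) -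
    LinearMap.mulLeft ℂ (polarPoly y M) ∘ₗ derivative -
      (δ * k) • LinearMap.mulLeft ℂ (X - C (y 1))

section HeunOp

variable {y : Fin 2 → ℂ} {M : Fin 2 → ℕ} {δ E : ℂ} {k : ℕ} {p r : ℂ[X]}

theorem heunOp_apply (y : Fin 2 → ℂ) (M : Fin 2 → ℕ) (δ : ℂ) (k : ℕ) (p : ℂ[X]) :
    heunOp y M δ k p =
      nodePoly y * (derivative (derivative p) + C δ * derivative p) - polarPoly y M * derivative p -
        C (δ * k) * ((X - C (y 1)) * p) := by
  simp [heunOp, smul_eq_C_mul]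

theorem coeff_heunOp_succ (y : Fin 2 → ℂ) (M : Fin 2 → ℕ) (δ : ℂ) (k j : ℕ) (p : ℂ[X]) :
    (heunOp y M δ k p).coeff (j + 1) = δ * (j - k) * p.coeff j +
      ((j + 1) * (j - δ * (y 0 + y 1) - M 0 - M 1) + δ * k * y 1) * p.coeff (j + 1) +
      (j + 2) * (δ * (y 0 * y 1) - (j + 1) * (y 0 + y 1) + M 0 * y 1 + M 1 * y 0) *
        p.coeff (j + 2) +
      y 0 * y 1 * ((j + 2) * (j + 3)) * p.coeff (j + 3) := by
  have hX (q : ℂ[X]) (j : ℕ) : (X * derivative q).coeff j = j * q.coeff j := by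
    cases j <;> simp [coeff_derivative, mul_comm]
  have expand : heunOp y M δ k p =
      X * (X * derivative (derivative p)) - C (y 0 + y 1) * (X * derivative (derivative p)) +
        C (y 0 * y 1) * derivative (derivative p) + C δ * (X * (X * derivative p)) -
        C (δ * (y 0 + y 1) + M 0 + M 1) * (X * derivative p) +
        C (δ * (y 0 * y 1) + M 0 * y 1 + M 1 * y 0) * derivative p - C (δ * k) * (X * p) +
        C (δ * k * y 1) * p := by
    simp only [heunOp_apply, nodePoly, polarPoly, C_add, C_mul]
    ring
  rw [expand]
  simp only [coeff_add, coeff_sub, coeff_C_mul, coeff_X_mul, hX, coeff_derivative]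
  push_cast
  ring

theorem natDegree_heunOp_le (hp : p.natDegree ≤ k) : (heunOp y M δ k p).natDegree ≤ k := by
  refine natDegree_le_iff_coeff_eq_zero.2 fun i hi => ?_
  obtain ⟨j, rfl⟩ : ∃ j, i = j + 1 := ⟨i - 1, by omega⟩
  have vanish (b : ℕ) (hb : k < b) : p.coeff b = 0 := coeff_eq_zero_of_natDegree_lt (by omega)
  rw [coeff_heunOp_succ, vanish (j + 1) hi, vanish (j + 2) (by omega), vanish (j + 3) (by omega)]
  obtain rfl | hj := eq_or_ne j k
  · simp
  · simp [vanish j (by omega)]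

theorem eq_zero_of_heunOp_eq_smul (hδ : δ ≠ 0) (h : heunOp y M δ k p = E • p)
    (hk : p.coeff k = 0) : p = 0 := by
  by_contra hp
  have hlead : p.coeff p.natDegree ≠ 0 := leadingCoeff_ne_zero.2 hp
  have hne : p.natDegree ≠ k := fun h' => hlead (h' ▸ hk)
  have hcoeff := congrArg (fun q => q.coeff (p.natDegree + 1)) h
  have vanish (i : ℕ) : p.coeff (p.natDegree + (i + 1)) = 0 :=
    coeff_eq_zero_of_natDegree_lt (by omega)
  simp only [coeff_heunOp_succ, coeff_smul, vanish, mul_zero, add_zero, smul_eq_mul] at hcoeff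
  exact mul_ne_zero (mul_ne_zero hδ (sub_ne_zero.2 (Nat.cast_injective.ne hne))) hlead hcoeff

theorem coeff_smul_eq_of_heunOp_eq_smul (hδ : δ ≠ 0) (hp : heunOp y M δ k p = E • p)
    (hr : heunOp y M δ k r = E • r) : r.coeff k • p = p.coeff k • r := by
  have hdiff : heunOp y M δ k (r.coeff k • p - p.coeff k • r) =
      E • (r.coeff k • p - p.coeff k • r) := by
    rw [map_sub, map_smul, map_smul, hp, hr]
    module
  exact sub_eq_zero.1 (eq_zero_of_heunOp_eq_smul hδ hdiff (by simp [mul_comm]))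

end HeunOp

/-! ### Two-point expansions -/

open Finset.HasAntidiagonal (antidiagonal mem_antidiagonal)

/-- The divided power `(X - a) ^ j / j!`. -/
noncomputable def dividedPow (a : ℂ) (j : ℕ) : ℂ[X] := C (j.factorial : ℂ)⁻¹ * (X - C a) ^ j

theorem dividedPow_zero (a : ℂ) : dividedPow a 0 = 1 := by simp [dividedPow]

theorem X_sub_C_mul_dividedPow (a : ℂ) (j : ℕ) :
    (X - C a) * dividedPow a j = C (j + 1 : ℂ) * dividedPow a (j + 1) := by
  have hj : (j + 1 : ℂ) ≠ 0 := j.cast_add_one_ne_zero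
  have hC : C (j.factorial : ℂ)⁻¹ = C (j + 1 : ℂ) * C ((j + 1).factorial : ℂ)⁻¹ := by
    rw [← C_mul, Nat.factorial_succ]
    congr 1
    push_cast
    field_simp
  rw [dividedPow, dividedPow, hC]
  ring

theorem derivative_dividedPow_succ (a : ℂ) (j : ℕ) :
    derivative (dividedPow a (j + 1)) = dividedPow a j := by
  have hj : (j + 1 : ℂ) ≠ 0 := j.cast_add_one_ne_zero
  rw [dividedPow, dividedPow, derivative_C_mul, derivative_X_sub_C_pow, ← mul_assoc,
    Nat.add_sub_cancel, ← C_mul, Nat.factorial_succ]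
  congr 2
  push_cast
  field_simp

theorem twoPointPoly_eq_sum_antidiagonal (y : Fin 2 → ℂ) (k : ℕ) (c : ℕ → ℂ) :
    twoPointPoly y k c = ∑ ij ∈ antidiagonal k,
      c ij.2 • (dividedPow (y 0) ij.1 * dividedPow (y 1) ij.2) := by
  rw [← Finset.Nat.sum_antidiagonal_swap, Finset.Nat.sum_antidiagonal_eq_sum_range_succ_mk]
  refine Finset.sum_congr rfl fun i _ => ?_
  simp only [dividedPow, Prod.fst_swap, Prod.snd_swap, smul_eq_C_mul, div_eq_mul_inv, mul_inv,
    C_mul]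
  ring

section TwoPoint

variable {y : Fin 2 → ℂ} {k : ℕ} {c c' : ℕ → ℂ}

theorem twoPointPoly_congr (h : ∀ i ≤ k, c i = c' i) :
    twoPointPoly y k c = twoPointPoly y k c' :=
  Finset.sum_congr rfl fun i hi => by rw [h i (Finset.mem_range_succ_iff.1 hi)]

variable (y k c c')

theorem twoPointPoly_add :
    twoPointPoly y k (c + c') = twoPointPoly y k c + twoPointPoly y k c' := by
  simp only [twoPointPoly_eq_sum_antidiagonal, Pi.add_apply, add_smul, Finset.sum_add_distrib]

theorem twoPointPoly_smul (a : ℂ) : twoPointPoly y k (a • c) = a • twoPointPoly y k c := by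
  simp only [twoPointPoly_eq_sum_antidiagonal, Pi.smul_apply, smul_assoc, Finset.smul_sum]

/-- The polynomial with prescribed two-point coefficients, as a linear function of them. -/
noncomputable def twoPointLinearMap : (ℕ → ℂ) →ₗ[ℂ] ℂ[X] where
  toFun := twoPointPoly y k
  map_add' := twoPointPoly_add y k
  map_smul' a c := twoPointPoly_smul y k c a

theorem twoPointLinearMap_apply : twoPointLinearMap y k c = twoPointPoly y k c := rfl

theorem derivative_twoPointPoly_succ :
    derivative (twoPointPoly y (k + 1) c) = twoPointPoly y k fun i => c i + c (i + 1) := by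
  have hsplit : derivative (twoPointPoly y (k + 1) c) =
      ∑ ij ∈ antidiagonal (k + 1),
        c ij.2 • (derivative (dividedPow (y 0) ij.1) * dividedPow (y 1) ij.2) +
      ∑ ij ∈ antidiagonal (k + 1),
        c ij.2 • (dividedPow (y 0) ij.1 * derivative (dividedPow (y 1) ij.2)) := by
    simp only [twoPointPoly_eq_sum_antidiagonal, derivative_sum, derivative_smul, derivative_mul,
      smul_add, Finset.sum_add_distrib]
  rw [hsplit, Finset.Nat.sum_antidiagonal_succ, Finset.Nat.sum_antidiagonal_succ']
  simp only [dividedPow_zero, derivative_one, zero_mul, mul_zero, smul_zero, zero_add,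
    derivative_dividedPow_succ, twoPointPoly_eq_sum_antidiagonal, add_smul, Finset.sum_add_distrib]

theorem X_sub_C_zero_mul_twoPointPoly :
    (X - C (y 0)) * twoPointPoly y k c = twoPointPoly y (k + 1) fun i => (k + 1 - i) * c i := by
  simp only [twoPointPoly_eq_sum_antidiagonal]
  rw [Finset.Nat.sum_antidiagonal_succ, Finset.mul_sum]
  simp only [Nat.cast_add, Nat.cast_one, sub_self, zero_mul, zero_smul, zero_add]
  refine Finset.sum_congr rfl fun ij hij => ?_
  have hk : (k : ℂ) = ij.1 + ij.2 := by exact_mod_cast (mem_antidiagonal.1 hij).symm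
  rw [hk, mul_smul_comm, ← mul_assoc, X_sub_C_mul_dividedPow]
  simp only [smul_eq_C_mul, C_mul, C_add, C_sub]
  ring

theorem X_sub_C_one_mul_twoPointPoly :
    (X - C (y 1)) * twoPointPoly y k c = twoPointPoly y (k + 1) fun i => i * c (i - 1) := by
  simp only [twoPointPoly_eq_sum_antidiagonal]
  rw [Finset.Nat.sum_antidiagonal_succ']
  simp only [Nat.cast_zero, zero_mul, zero_smul, zero_add, Nat.add_sub_cancel, Finset.mul_sum]
  refine Finset.sum_congr rfl fun ij _ => ?_
  rw [mul_smul_comm, mul_left_comm, X_sub_C_mul_dividedPow]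
  simp only [smul_eq_C_mul, C_mul, C_add, Nat.cast_add, Nat.cast_one]
  ring

theorem X_sub_C_zero_mul_derivative_twoPointPoly :
    (X - C (y 0)) * derivative (twoPointPoly y k c) =
      twoPointPoly y k fun i => (k - i) * (c i + c (i + 1)) := by
  cases k with
  | zero => simp [twoPointPoly]
  | succ k => rw [derivative_twoPointPoly_succ, X_sub_C_zero_mul_twoPointPoly, Nat.cast_succ]

theorem X_sub_C_one_mul_derivative_twoPointPoly :
    (X - C (y 1)) * derivative (twoPointPoly y k c) =
      twoPointPoly y k fun i => i * (c i + c (i - 1)) := by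
  cases k with
  | zero => simp [twoPointPoly]
  | succ k =>
    rw [derivative_twoPointPoly_succ, X_sub_C_one_mul_twoPointPoly]
    refine twoPointPoly_congr fun i _ => ?_
    cases i with
    | zero => simp
    | succ i => rw [Nat.add_sub_cancel, add_comm (c i)]

theorem succ_mul_twoPointPoly_succ :
    C (k + 1 : ℂ) * twoPointPoly y (k + 1) c =
      (X - C (y 0)) * twoPointPoly y k c +
        (X - C (y 1)) * twoPointPoly y k fun i => c (i + 1) := by
  rw [X_sub_C_zero_mul_twoPointPoly, X_sub_C_one_mul_twoPointPoly, ← twoPointPoly_add,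
    ← smul_eq_C_mul, ← twoPointPoly_smul]
  refine twoPointPoly_congr fun i _ => ?_
  cases i with
  | zero => simp
  | succ i => simp only [Pi.smul_apply, Pi.add_apply, smul_eq_mul, Nat.add_sub_cancel]; ring

theorem X_sub_C_mul_derivative_sub_twoPointPoly :
    (X - C (y 1)) * ((X - C (y 0)) * derivative (twoPointPoly y k c) -
      C (k : ℂ) * twoPointPoly y k c) = twoPointPoly y k ((y 1 - y 0) • fun i => i * c i) := by
  cases k with
  | zero => simp [twoPointPoly]
  | succ k =>
    have hdiff : (X - C (y 0)) * derivative (twoPointPoly y (k + 1) c) -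
        C ((k + 1 : ℕ) : ℂ) * twoPointPoly y (k + 1) c =
        C (y 1 - y 0) * twoPointPoly y k fun i => c (i + 1) := by
      rw [Nat.cast_succ, succ_mul_twoPointPoly_succ, derivative_twoPointPoly_succ]
      change (X - C (y 0)) * twoPointPoly y k (c + fun i => c (i + 1)) - _ = _
      rw [twoPointPoly_add, C_sub]
      ring
    rw [hdiff, mul_left_comm, X_sub_C_one_mul_twoPointPoly, twoPointPoly_smul, smul_eq_C_mul]
    refine congrArg _ (twoPointPoly_congr fun i _ => ?_)
    cases i with
    | zero => simp
    | succ i => rw [Nat.add_sub_cancel]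

theorem eval_twoPointPoly_zero :
    (twoPointPoly y k c).eval (y 0) = c k / k.factorial * (y 0 - y 1) ^ k := by
  rw [twoPointPoly, eval_finsetSum, Finset.sum_range_succ, Finset.sum_eq_zero]
  · simp
  · intro i hi
    have hik : k - i ≠ 0 := Nat.sub_ne_zero_of_lt (Finset.mem_range.1 hi)
    simp [hik]

theorem eval_twoPointPoly_one :
    (twoPointPoly y k c).eval (y 1) = c 0 / k.factorial * (y 1 - y 0) ^ k := by
  rw [twoPointPoly, eval_finsetSum, Finset.sum_range_succ', Finset.sum_eq_zero] <;> simp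

variable {y k c}

theorem coeff_eq_zero_of_twoPointPoly_eq_zero (hy : y 0 ≠ y 1) (h : twoPointPoly y k c = 0) :
    ∀ i ≤ k, c i = 0 := by
  induction k generalizing c with
  | zero =>
    intro i hi
    rw [Nat.le_zero.1 hi]
    simpa [twoPointPoly] using h
  | succ k ih =>
    have h₀ : c 0 = 0 := by
      have heval := congrArg (eval (y 1)) h
      rw [eval_twoPointPoly_one, eval_zero] at heval
      simpa [sub_eq_zero, hy.symm, Nat.factorial_ne_zero] using heval
    have hsucc := ih ((derivative_twoPointPoly_succ y k c).symm.trans (by rw [h, derivative_zero]))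
    intro i hi
    induction i with
    | zero => exact h₀
    | succ i ihi => simpa [ihi (by omega)] using hsucc i (by omega)

theorem twoPointPoly_eq_iff (hy : y 0 ≠ y 1) {c' : ℕ → ℂ} :
    twoPointPoly y k c = twoPointPoly y k c' ↔ ∀ i ≤ k, c i = c' i := by
  refine ⟨fun h i hi => sub_eq_zero.1 ?_, twoPointPoly_congr⟩
  have hsub : twoPointPoly y k (c - c') = 0 := by
    rw [← twoPointLinearMap_apply, map_sub, twoPointLinearMap_apply, twoPointLinearMap_apply, h,
      sub_self]
  exact coeff_eq_zero_of_twoPointPoly_eq_zero hy hsub i hi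

end TwoPoint

/-! ### The three-term recurrence -/

/-- The tridiagonal operator through which `heunOp y M δ k` acts on two-point coefficients, where
`ε = δ (y₂ - y₁)`. -/
noncomputable def heunRec (M : Fin 2 → ℕ) (ε : ℂ) (k : ℕ) : Module.End ℂ (ℕ → ℂ) where
  toFun c i := i * (k - i - M 0) * c (i - 1) +
    (2 * i * (k - i) - M 0 * i - M 1 * (k - i) + ε * i) * c i + (k - i) * (i - M 1) * c (i + 1)
  map_add' c c' := by ext i; simp only [Pi.add_apply]; ring
  map_smul' a c := by ext i; simp only [Pi.smul_apply, smul_eq_mul, RingHom.id_apply]; ring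

section HeunRec

variable {y : Fin 2 → ℂ} {M m n : Fin 2 → ℕ} {δ E : ℂ} {k : ℕ} {c : ℕ → ℂ}

theorem heunRec_apply (M : Fin 2 → ℕ) (ε : ℂ) (k : ℕ) (c : ℕ → ℂ) (i : ℕ) :
    heunRec M ε k c i = i * (k - i - M 0) * c (i - 1) +
      (2 * i * (k - i) - M 0 * i - M 1 * (k - i) + ε * i) * c i +
        (k - i) * (i - M 1) * c (i + 1) := rfl

theorem heunOp_twoPointPoly (y : Fin 2 → ℂ) (M : Fin 2 → ℕ) (δ : ℂ) (k : ℕ) (c : ℕ → ℂ) :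
    heunOp y M δ k (twoPointPoly y k c) =
      twoPointPoly y k (heunRec M (δ * (y 1 - y 0)) k c) := by
  have hnode : nodePoly y * derivative (derivative (twoPointPoly y k c)) =
      twoPointPoly y k (fun i => i * ((k - i) * (c i + c (i + 1)) +
        (k - (i - 1 : ℕ)) * (c (i - 1) + c (i - 1 + 1)))) -
      twoPointPoly y k (fun i => i * (c i + c (i - 1))) := by
    rw [← X_sub_C_one_mul_derivative_twoPointPoly y k (fun i => (k - i) * (c i + c (i + 1))),
      ← X_sub_C_one_mul_derivative_twoPointPoly, ← X_sub_C_zero_mul_derivative_twoPointPoly,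
      derivative_mul, derivative_X_sub_C, nodePoly]
    ring
  have hsplit : heunOp y M δ k (twoPointPoly y k c) =
      nodePoly y * derivative (derivative (twoPointPoly y k c)) +
      δ • ((X - C (y 1)) * ((X - C (y 0)) * derivative (twoPointPoly y k c) -
        C (k : ℂ) * twoPointPoly y k c)) -
      (M 0 : ℂ) • ((X - C (y 1)) * derivative (twoPointPoly y k c)) -
      (M 1 : ℂ) • ((X - C (y 0)) * derivative (twoPointPoly y k c)) := by
    simp only [heunOp_apply, nodePoly, polarPoly, smul_eq_C_mul, C_mul]
    ring
  rw [hsplit, hnode, X_sub_C_mul_derivative_sub_twoPointPoly,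
    X_sub_C_zero_mul_derivative_twoPointPoly, X_sub_C_one_mul_derivative_twoPointPoly]
  simp only [← twoPointLinearMap_apply, ← map_smul, ← map_sub, ← map_add]
  refine twoPointPoly_congr fun i _ => ?_
  simp only [heunRec_apply, Pi.add_apply, Pi.sub_apply, Pi.smul_apply, smul_eq_mul]
  cases i with
  | zero =>
    simp only [CharP.cast_eq_zero, sub_zero, zero_add, zero_tsub, zero_mul, sub_self,
      mul_zero, add_zero, zero_sub, neg_mul, mul_neg]
    ring
  | succ i => rw [Nat.add_sub_cancel]; push_cast; ring

theorem heunOp_twoPointPoly_eq_smul_iff (hy : y 0 ≠ y 1) :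
    heunOp y M δ k (twoPointPoly y k c) = E • twoPointPoly y k c ↔
      ∀ i ≤ k, heunRec M (δ * (y 1 - y 0)) k c i = E * c i := by
  rw [heunOp_twoPointPoly, ← twoPointPoly_smul, twoPointPoly_eq_iff hy]
  rfl

/-- The entry of `heunRec M ε k` in row `k - M₁` and column `k - M₁ - 1` vanishes. -/
theorem heunRec_truncate {ε : ℂ} (hc : ∀ i ≤ k, heunRec M ε k c i = E * c i)
    (hzero : c (k - M 0) = 0) :
    ∀ i ≤ k, heunRec M ε k (fun j => if j < k - M 0 then c j else 0) i =
      E * if i < k - M 0 then c i else 0 := by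
  intro i hi
  obtain hlt | rfl | hgt := lt_trichotomy i (k - M 0)
  · have hnext : (if i + 1 < k - M 0 then c (i + 1) else 0) = c (i + 1) := by
      split_ifs with h
      · rfl
      · rw [← hzero, show i + 1 = k - M 0 by omega]
    rw [if_pos hlt, ← hc i hi, heunRec_apply, heunRec_apply, hnext, if_pos hlt,
      if_pos (by omega : i - 1 < k - M 0)]
  · rcases le_total k (M 0) with hk | hk
    · simp [heunRec_apply, Nat.sub_eq_zero_of_le hk]
    · simp [heunRec_apply, Nat.cast_sub hk]
  · simp [heunRec_apply, show ¬ i < k - M 0 by omega, show ¬ i - 1 < k - M 0 by omega,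
      show ¬ i + 1 < k - M 0 by omega]

theorem coeff_ne_zero_of_eval_ne_zero (hy : y 0 ≠ y 1) (hδ : δ ≠ 0)
    (h : heunOp y M δ k (twoPointPoly y k c) = E • twoPointPoly y k c)
    (hne : ∀ a, (twoPointPoly y k c).eval (y a) ≠ 0) : c (k - M 0) ≠ 0 := by
  intro hzero
  set p := twoPointPoly y k c with hp
  set r := twoPointPoly y k fun j => if j < k - M 0 then c j else 0 with hr
  have hrE : heunOp y M δ k r = E • r :=
    (heunOp_twoPointPoly_eq_smul_iff hy).2
      (heunRec_truncate ((heunOp_twoPointPoly_eq_smul_iff hy).1 h) hzero)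
  have hprop : r.coeff k • p = p.coeff k • r := coeff_smul_eq_of_heunOp_eq_smul hδ h hrE
  have hr₀ : r.eval (y 0) = 0 := by simp [hr, eval_twoPointPoly_zero]
  have hr₁ : r.eval (y 1) = p.eval (y 1) := by
    rw [hr, hp, eval_twoPointPoly_one, eval_twoPointPoly_one]
    split_ifs with hpos
    · rfl
    · rw [← hzero, show k - M 0 = 0 by omega]
  have hrk : r.coeff k = 0 := by
    simpa [hr₀, hne 0] using congrArg (eval (y 0)) hprop
  have hpk : p.coeff k = 0 := by
    simpa [hr₁, hne 1, hrk] using congrArg (eval (y 1)) hprop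
  exact hne 0 (by rw [eq_zero_of_heunOp_eq_smul hδ h hpk, eval_zero])

theorem heunRec_reverse (hnm : n 0 + n 1 = m 0 + m 1) (ε : ℂ) (c : ℕ → ℂ) {i : ℕ} (hi : i ≤ m 1) :
    heunRec m ε (n 1) (fun j => c (m 1 - j)) i =
      heunRec m (-ε) (n 0) c (m 1 - i) + ε * m 1 * c (m 1 - i) := by
  have hn : (n 0 : ℂ) = m 0 + m 1 - n 1 := by
    rw [eq_sub_iff_add_eq]; exact_mod_cast hnm
  simp only [heunRec_apply, Nat.cast_sub hi, hn]
  rw [show m 1 - (i + 1) = m 1 - i - 1 by omega]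
  cases i with
  | zero =>
    simp only [CharP.cast_eq_zero, sub_zero, zero_add, zero_tsub, tsub_zero, zero_mul, sub_self,
      mul_zero, add_zero, zero_sub, neg_mul, mul_neg]
    ring
  | succ i =>
    rw [show m 1 - (i + 1 - 1) = m 1 - (i + 1) + 1 by omega]
    push_cast
    ring

theorem heunRec_dual (hnm : n 0 + n 1 = m 0 + m 1) (ε : ℂ) :
    heunRec n ε (m 1) = heunRec m ε (n 1) := by
  have hn : (n 0 : ℂ) = m 0 + m 1 - n 1 := by
    rw [eq_sub_iff_add_eq]; exact_mod_cast hnm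
  ext c i
  simp only [heunRec_apply, hn]
  ring

/-- The sequences satisfying the rows `k - M₁ ≤ i < min M₂ k` of the recurrence
`heunRec M ε k c = E • c`. In these rows the coefficient of `c (i + 1)` does not vanish, and they
involve no `c i` outside the range of summation of `betheSum M k`. -/
noncomputable def blockSolutions (M : Fin 2 → ℕ) (ε : ℂ) (k : ℕ) (E : ℂ) :
    Submodule ℂ (ℕ → ℂ) where
  carrier := {c | ∀ i, k - M 0 ≤ i → i < min (M 1) k → heunRec M ε k c i = E * c i}
  add_mem' hc hc' i hi hi' := by
    rw [map_add, Pi.add_apply, hc i hi hi', hc' i hi hi', Pi.add_apply, mul_add]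
  zero_mem' i _ _ := by simp
  smul_mem' a c hc i hi hi' := by
    rw [map_smul, Pi.smul_apply, hc i hi hi', Pi.smul_apply, smul_eq_mul, smul_eq_mul,
      mul_left_comm]

variable {ε : ℂ}

theorem eq_zero_of_mem_blockSolutions (hc : c ∈ blockSolutions M ε k E)
    (hzero : c (k - M 0) = 0) : ∀ i, k - M 0 ≤ i → i ≤ min (M 1) k → c i = 0 := by
  intro i
  induction i using Nat.strong_induction_on with
  | _ i ih =>
    intro hi hi'
    obtain rfl | hlt := hi.eq_or_lt
    · exact hzero
    obtain ⟨j, rfl⟩ : ∃ j, i = j + 1 := ⟨i - 1, by omega⟩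
    have hprev : (j : ℂ) * (k - j - M 0) * c (j - 1) = 0 := by
      obtain h | h := (Nat.lt_succ_iff.1 hlt).eq_or_lt
      · obtain hk | hk := le_total k (M 0)
        · simp [← h, Nat.sub_eq_zero_of_le hk]
        · simp [← h, Nat.cast_sub hk]
      · rw [ih (j - 1) (by omega) (by omega) (by omega), mul_zero]
    have hrow := hc j (by omega) (by omega)
    rw [heunRec_apply, hprev, ih j (by omega) (by omega) (by omega)] at hrow
    have hentry : ((k : ℂ) - j) * (j - M 1) ≠ 0 :=
      mul_ne_zero (sub_ne_zero.2 (Nat.cast_injective.ne (by omega)))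
        (sub_ne_zero.2 (Nat.cast_injective.ne (by omega)))
    simpa [hentry] using hrow

theorem exists_blockSolutions_eq_smul (M : Fin 2 → ℕ) (ε : ℂ) (k : ℕ) (E : ℂ) :
    ∃ x : ℕ → ℂ, x (k - M 0) = 1 ∧ ∀ c ∈ blockSolutions M ε k E,
      ∀ i ∈ Finset.Icc (k - M 0) (min (M 1) k), c i = c (k - M 0) * x i := by
  by_cases h : ∃ b ∈ blockSolutions M ε k E, b (k - M 0) ≠ 0
  · obtain ⟨b, hb, hb₀⟩ := h
    refine ⟨(b (k - M 0))⁻¹ • b, inv_mul_cancel₀ hb₀, fun c hc i hi => ?_⟩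
    have hdiff : c - (c (k - M 0) * (b (k - M 0))⁻¹) • b ∈ blockSolutions M ε k E :=
      sub_mem hc (Submodule.smul_mem _ _ hb)
    have hi' := Finset.mem_Icc.1 hi
    have := eq_zero_of_mem_blockSolutions hdiff (by simp [hb₀]) i hi'.1 hi'.2
    simpa [sub_eq_zero, mul_assoc] using this
  · push Not at h
    refine ⟨fun _ => 1, rfl, fun c hc i hi => ?_⟩
    have hi' := Finset.mem_Icc.1 hi
    rw [eq_zero_of_mem_blockSolutions hc (h c hc) i hi'.1 hi'.2, h c hc, zero_mul]

end HeunRec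

/-! ### Critical points of the master function -/

theorem prod_prod_filter_lt_eq_mul {ι R : Type*} [Fintype ι] [LinearOrder ι] [CommMonoid R]
    {f : ι → ι → R} (hf : ∀ i i', f i i' = f i' i) (j : ι) :
    ∏ i, ∏ i' with i < i', f i i' =
      (∏ i ∈ Finset.univ.erase j, f j i) *
        ∏ i ∈ Finset.univ.erase j, ∏ i' ∈ Finset.univ.erase j with i < i', f i i' := by
  have hrow : ∏ i' with j < i', f j i' =
      ∏ i ∈ Finset.univ.erase j, if j < i then f j i else 1 := by
    rw [Finset.prod_filter, ← Finset.mul_prod_erase _ _ (Finset.mem_univ j)]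
    simp
  have hcol (i : ι) : ∏ i' with i < i', f i i' =
      (if i < j then f i j else 1) * ∏ i' ∈ Finset.univ.erase j with i < i', f i i' := by
    rw [Finset.prod_filter, Finset.prod_filter,
      Finset.mul_prod_erase _ (fun i' => if i < i' then f i i' else 1) (Finset.mem_univ j)]
  rw [← Finset.mul_prod_erase _ _ (Finset.mem_univ j), hrow]
  simp only [hcol, Finset.prod_mul_distrib]
  rw [← mul_assoc, ← Finset.prod_mul_distrib]
  congr 1
  refine Finset.prod_congr rfl fun i hi => ?_
  obtain h | h := (Finset.ne_of_mem_erase hi).lt_or_gt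
  · simp [h, h.not_gt, hf i j]
  · simp [h, h.not_gt]

theorem prod_comp_update {ι α R : Type*} [Fintype ι] [DecidableEq ι] [CommMonoid R] (t : ι → α)
    (j : ι) (s : α) (f : α → R) :
    ∏ i, f (Function.update t j s i) = f s * ∏ i ∈ Finset.univ.erase j, f (t i) := by
  rw [← Finset.mul_prod_erase _ _ (Finset.mem_univ j), Function.update_self]
  congr 1
  exact Finset.prod_congr rfl fun i hi => by rw [Function.update_of_ne (Finset.ne_of_mem_erase hi)]

theorem exists_masterFunction_update (l y : Fin 2 → ℂ) (M : Fin 2 → ℕ) {k : ℕ} (t : Fin k → ℂ)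
    (j : Fin k) : ∃ K : ℂ, ∀ s, masterFunction l y M (Function.update t j s) =
      K * (Complex.exp ((l 1 - l 0) * s) *
        (∏ i ∈ Finset.univ.erase j, (X - C (t i))).eval s ^ 2 *
        ((nodePowPoly y M).eval s)⁻¹) := by
  refine ⟨Complex.exp (l 0 * (M 0 * y 0 + M 1 * y 1) +
      (l 1 - l 0) * ∑ i ∈ Finset.univ.erase j, t i) * (y 0 - y 1) ^ (M 0 * M 1) *
    (∏ i ∈ Finset.univ.erase j, ((t i - y 0) ^ M 0)⁻¹ * ((t i - y 1) ^ M 1)⁻¹) *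
    ∏ i ∈ Finset.univ.erase j, ∏ i' ∈ Finset.univ.erase j with i < i', (t i - t i') ^ 2,
    fun s => ?_⟩
  have hsum : ∑ i, Function.update t j s i = s + ∑ i ∈ Finset.univ.erase j, t i := by
    rw [Finset.sum_update_of_mem (Finset.mem_univ j), Finset.sdiff_singleton_eq_erase]
  have hpairs : ∏ i, ∏ i' with i < i', (Function.update t j s i - Function.update t j s i') ^ 2 =
      (∏ i ∈ Finset.univ.erase j, (s - t i)) ^ 2 *
        ∏ i ∈ Finset.univ.erase j, ∏ i' ∈ Finset.univ.erase j with i < i', (t i - t i') ^ 2 := by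
    rw [prod_prod_filter_lt_eq_mul (fun i i' => by ring) j, ← Finset.prod_pow]
    congr 1
    · refine Finset.prod_congr rfl fun i hi => ?_
      rw [Function.update_self, Function.update_of_ne (Finset.ne_of_mem_erase hi)]
    · refine Finset.prod_congr rfl fun i hi => Finset.prod_congr rfl fun i' hi' => ?_
      rw [Function.update_of_ne (Finset.ne_of_mem_erase hi),
        Function.update_of_ne (Finset.ne_of_mem_erase (Finset.mem_filter.1 hi').1)]
  rw [masterFunction, hpairs, hsum,
    prod_comp_update t j s fun x => ((x - y 0) ^ M 0)⁻¹ * ((x - y 1) ^ M 1)⁻¹, mul_add (l 1 - l 0),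
    add_left_comm, Complex.exp_add ((l 1 - l 0) * s), eval_prod]
  simp only [nodePowPoly, eval_mul, eval_pow, eval_sub, eval_X, eval_C, mul_inv]
  ring

theorem hasDerivAt_exp_mul_sq_div {δ x : ℂ} {Q A : ℂ[X]} (hA : A.eval x ≠ 0)
    (h : (2 * (derivative Q).eval x + δ * Q.eval x) * A.eval x =
      Q.eval x * (derivative A).eval x) :
    HasDerivAt (fun s => Complex.exp (δ * s) * Q.eval s ^ 2 * (A.eval s)⁻¹) 0 x := by
  have hexp : HasDerivAt (fun s : ℂ => Complex.exp (δ * s)) (Complex.exp (δ * x) * (δ * 1)) x :=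
    ((hasDerivAt_id x).const_mul δ).cexp
  refine ((hexp.mul ((Q.hasDerivAt x).pow 2)).mul ((A.hasDerivAt x).fun_inv hA)).congr_deriv ?_
  simp only [Pi.mul_apply, Pi.pow_apply]
  field_simp
  push_cast
  linear_combination Complex.exp (δ * x) * Q.eval x * h

theorem bethe_equation_of_heunOp_eq_smul {y : Fin 2 → ℂ} {M : Fin 2 → ℕ} {δ E x : ℂ} {k : ℕ}
    {Q : ℂ[X]} (h : heunOp y M δ k ((X - C x) * Q) = E • ((X - C x) * Q)) :
    (nodePoly y).eval x * (2 * (derivative Q).eval x + δ * Q.eval x) =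
      (polarPoly y M).eval x * Q.eval x := by
  have heval := congrArg (eval x) h
  rw [heunOp_apply] at heval
  simp only [derivative_mul, derivative_X_sub_C, derivative_add, eval_add, eval_sub, eval_mul,
    eval_smul, eval_X, eval_C, sub_self, zero_mul, one_mul, mul_zero, smul_zero,
    add_zero, sub_zero] at heval
  linear_combination heval

theorem isCriticalPoint_of_heunOp_eq_smul {l y : Fin 2 → ℂ} {M : Fin 2 → ℕ} {E : ℂ} {k d : ℕ}
    {p : ℂ[X]} {t : Fin d → ℂ} (h : heunOp y M (l 1 - l 0) k p = E • p) (hp : Represents p t)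
    (ht : IsAdmissible y t) : IsCriticalPoint l y M t := by
  intro j
  obtain ⟨a, ha, rfl⟩ := hp
  obtain ⟨K, hK⟩ := exists_masterFunction_update l y M t j
  set Q : ℂ[X] := ∏ i ∈ Finset.univ.erase j, (X - C (t i))
  set A := nodePowPoly y M with hAdef
  have hbethe : (nodePoly y).eval (t j) * (2 * (derivative Q).eval (t j) +
      (l 1 - l 0) * Q.eval (t j)) = (polarPoly y M).eval (t j) * Q.eval (t j) := by
    rw [← Finset.mul_prod_erase _ _ (Finset.mem_univ j), ← smul_eq_C_mul, map_smul,
      smul_comm E] at h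
    exact bethe_equation_of_heunOp_eq_smul (smul_right_injective _ ha h)
  have hlog : (nodePoly y).eval (t j) * (derivative A).eval (t j) =
      (polarPoly y M).eval (t j) * A.eval (t j) := by
    rw [← eval_mul, ← eval_mul, hAdef, nodePoly_mul_derivative_nodePowPoly]
  have hcrit : (2 * (derivative Q).eval (t j) + (l 1 - l 0) * Q.eval (t j)) * A.eval (t j) =
      Q.eval (t j) * (derivative A).eval (t j) :=
    mul_left_cancel₀ (eval_nodePoly_ne_zero (ht.2 j))
      (by linear_combination A.eval (t j) * hbethe - Q.eval (t j) * hlog)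
  simpa only [hK, mul_zero] using
    (hasDerivAt_exp_mul_sq_div (eval_nodePowPoly_ne_zero (ht.2 j) M) hcrit).const_mul K

/-! ### Coefficients of the universal vector -/

theorem sum_perm_prod_eq_of_card_eq {ι R : Type*} [Fintype ι] [DecidableEq ι] [CommSemiring R]
    (u v : ι → R) {s s' : Finset ι} (h : s.card = s'.card) :
    ∑ σ : Equiv.Perm ι, (∏ j ∈ s, u (σ j)) * ∏ j ∈ sᶜ, v (σ j) =
      ∑ σ : Equiv.Perm ι, (∏ j ∈ s', u (σ j)) * ∏ j ∈ s'ᶜ, v (σ j) := by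
  obtain ⟨τ, rfl⟩ := Equiv.Perm.exists_map_finset_eq s s' h
  have hcompl : (s.map τ.toEmbedding)ᶜ = sᶜ.map τ.toEmbedding := by
    ext j
    simp
  rw [← Equiv.sum_comp (Equiv.mulRight τ)]
  simp [hcompl]

theorem factorial_mul_prod_add {R : Type*} [CommSemiring R] {k : ℕ} (u v : Fin k → R) :
    (k.factorial : R) * ∏ j, (u j + v j) =
      ∑ i ∈ Finset.range (k + 1), (k.choose i : R) * ∑ σ : Equiv.Perm (Fin k), ∏ j : Fin k,
        if (j : ℕ) < k - i then u (σ j) else v (σ j) := by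
  have hsymm : (k.factorial : R) * ∏ j, (u j + v j) =
      ∑ σ : Equiv.Perm (Fin k), ∏ j, (u (σ j) + v (σ j)) := by
    simp only [fun σ : Equiv.Perm (Fin k) => Equiv.prod_comp σ fun j => u j + v j,
      Finset.sum_const, Finset.card_univ, Fintype.card_perm, Fintype.card_fin, nsmul_eq_mul]
  have hcard (s : Finset (Fin k)) :
      ∑ σ : Equiv.Perm (Fin k), (∏ j ∈ s, u (σ j)) * ∏ j ∈ sᶜ, v (σ j) =
        ∑ σ : Equiv.Perm (Fin k), ∏ j : Fin k,
          if (j : ℕ) < s.card then u (σ j) else v (σ j) := by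
    have hs : s.card = ({j : Fin k | (j : ℕ) < s.card} : Finset _).card := by
      rw [Fin.card_filter_val_lt, min_eq_right (by simpa using s.card_le_univ)]
    rw [sum_perm_prod_eq_of_card_eq u v hs]
    simp only [Finset.prod_ite, Finset.compl_filter]
  rw [hsymm]
  simp only [Fintype.prod_add]
  rw [Finset.sum_comm]
  simp only [hcard]
  rw [← Finset.powerset_univ, Finset.sum_powerset_apply_card fun i =>
      ∑ σ : Equiv.Perm (Fin k), ∏ j : Fin k, if (j : ℕ) < i then u (σ j) else v (σ j),
    Finset.card_univ, Fintype.card_fin, ← Finset.sum_range_reflect]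
  refine Finset.sum_congr rfl fun i hi => ?_
  rw [Nat.add_sub_cancel, Nat.choose_symm (Finset.mem_range_succ_iff.1 hi), nsmul_eq_mul]

theorem prod_ite_lt_mul {R : Type*} [CommMonoid R] {k i : ℕ} (hi : i ≤ k) (f g : Fin k → R)
    (A B : R) :
    ∏ j : Fin k, (if (j : ℕ) < k - i then f j * A else g j * B) =
      (∏ j : Fin k, if (j : ℕ) < k - i then f j else g j) * (A ^ (k - i) * B ^ i) := by
  have hlow : ({j : Fin k | (j : ℕ) < k - i} : Finset _).card = k - i := by
    rw [Fin.card_filter_val_lt, min_eq_right (Nat.sub_le k i)]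
  have hhigh : ({j : Fin k | ¬ (j : ℕ) < k - i} : Finset _).card = i := by
    rw [← Finset.compl_filter, Finset.card_compl, hlow, Fintype.card_fin, Nat.sub_sub_self hi]
  rw [Finset.prod_ite, Finset.prod_ite, Finset.prod_mul_distrib, Finset.prod_mul_distrib,
    Finset.prod_const, Finset.prod_const, hlow, hhigh, mul_mul_mul_comm]

theorem prod_linear_eq_twoPointPoly (y : Fin 2 → ℂ) {k : ℕ} (t : Fin k → ℂ) :
    ∏ j, (C (t j - y 0)⁻¹ * (X - C (y 0)) - C (t j - y 1)⁻¹ * (X - C (y 1))) =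
      twoPointPoly y k fun i => (-1) ^ i * betheCoeff y t i := by
  have hk : (k.factorial : ℂ[X]) ≠ 0 := Nat.cast_ne_zero.2 k.factorial_ne_zero
  refine mul_left_cancel₀ hk ?_
  simp only [sub_eq_add_neg _ (C _ * _), neg_mul_eq_mul_neg]
  rw [factorial_mul_prod_add, twoPointPoly, Finset.mul_sum]
  refine Finset.sum_congr rfl fun i hi => ?_
  have hik := Finset.mem_range_succ_iff.1 hi
  have hcoeff : (∑ σ : Equiv.Perm (Fin k), ∏ j : Fin k, if (j : ℕ) < k - i then
      C (t (σ j) - y 0)⁻¹ else C (t (σ j) - y 1)⁻¹) = C (betheCoeff y t i) := by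
    simp only [betheCoeff, map_sum, map_prod, apply_ite C]
  have hchoose : (k.choose i : ℂ[X]) * C ((-1) ^ i * betheCoeff y t i) = (k.factorial : ℂ[X]) *
      C ((-1) ^ i * betheCoeff y t i / ((k - i).factorial * i.factorial)) := by
    rw [← C_eq_natCast, ← C_eq_natCast, ← C_mul, ← C_mul, Nat.cast_choose ℂ hik]
    congr 1
    ring
  simp only [prod_ite_lt_mul hik, ← Finset.sum_mul]
  rw [hcoeff, ← mul_assoc (k.factorial : ℂ[X]), ← hchoose, neg_pow (X - C (y 1))]
  simp only [C_mul, map_pow, map_neg, map_one]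
  ring

theorem exists_betheCoeff_eq_smul {y : Fin 2 → ℂ} (hy : y 0 ≠ y 1) {k : ℕ} {c : ℕ → ℂ}
    {t : Fin k → ℂ} (hp : Represents (twoPointPoly y k c) t) (ht : IsAdmissible y t) :
    ∃ κ : ℂ, κ ≠ 0 ∧ ∀ i ≤ k, betheCoeff y t i = κ * ((-1) ^ i * c i) := by
  obtain ⟨a, ha, hpa⟩ := hp
  have hne (j : Fin k) (b : Fin 2) : t j - y b ≠ 0 := sub_ne_zero.2 (ht.2 j b)
  have hy' : y 0 - y 1 ≠ 0 := sub_ne_zero.2 hy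
  have hlin (j : Fin k) : (X - C (t j) : ℂ[X]) =
      C ((t j - y 0) * (t j - y 1) / (y 0 - y 1)) *
        (C (t j - y 0)⁻¹ * (X - C (y 0)) - C (t j - y 1)⁻¹ * (X - C (y 1))) := by
    have h₀ : (t j - y 0) * (t j - y 1) / (y 0 - y 1) * (t j - y 0)⁻¹ =
        (t j - y 1) * (y 0 - y 1)⁻¹ := by
      have := hne j 0
      field_simp
    have h₁ : (t j - y 0) * (t j - y 1) / (y 0 - y 1) * (t j - y 1)⁻¹ =
        (t j - y 0) * (y 0 - y 1)⁻¹ := by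
      have := hne j 1
      field_simp
    have hC : C (y 0 - y 1)⁻¹ * (C (y 0) - C (y 1)) = 1 := by
      rw [← C_sub, ← C_mul, inv_mul_cancel₀ hy', C_1]
    rw [mul_sub, ← mul_assoc, ← mul_assoc, ← C_mul, ← C_mul, h₀, h₁]
    simp only [C_mul, C_sub]
    linear_combination -(X - C (t j)) * hC
  set G : ℂ := ∏ j, ((t j - y 0) * (t j - y 1) / (y 0 - y 1))
  have hG : G ≠ 0 := Finset.prod_ne_zero_iff.2 fun j _ =>
    div_ne_zero (mul_ne_zero (hne j 0) (hne j 1)) hy'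
  have hexp : twoPointPoly y k c =
      twoPointPoly y k ((a * G) • fun i => (-1) ^ i * betheCoeff y t i) := by
    rw [twoPointPoly_smul, ← prod_linear_eq_twoPointPoly, hpa]
    simp only [hlin, Finset.prod_mul_distrib, ← map_prod, smul_eq_C_mul, C_mul, mul_assoc, G]
  refine ⟨(a * G)⁻¹, inv_ne_zero (mul_ne_zero ha hG), fun i hi => ?_⟩
  have hi := (twoPointPoly_eq_iff hy).1 hexp i hi
  rw [hi]
  have hsign : ((-1 : ℂ) ^ i) * (-1) ^ i = 1 := by rw [← mul_pow]; simp
  simp only [Pi.smul_apply, smul_eq_mul]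
  field_simp
  linear_combination -betheCoeff y t i * hsign

/-! ### Weight spaces and contingency tables -/

theorem mapDomain_add_mapDomain_eq_iff {α β : Fin 2 →₀ ℕ} {s : Fin 2 × Fin 2 →₀ ℕ} :
    α.mapDomain (Prod.mk 0) + β.mapDomain (Prod.mk 1) = s ↔
      α = s.curry 0 ∧ β = s.curry 1 := by
  have at_zero (i : Fin 2) :
      (α.mapDomain (Prod.mk 0) + β.mapDomain (Prod.mk 1) : Fin 2 × Fin 2 →₀ ℕ) (0, i) = α i := by
    rw [Finsupp.add_apply, Finsupp.mapDomain_apply (Prod.mk_right_injective 0),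
      Finsupp.mapDomain_of_notMem_range β _ (by simp), add_zero]
  have at_one (i : Fin 2) :
      (α.mapDomain (Prod.mk 0) + β.mapDomain (Prod.mk 1) : Fin 2 × Fin 2 →₀ ℕ) (1, i) = β i := by
    rw [Finsupp.add_apply, Finsupp.mapDomain_apply (Prod.mk_right_injective 1),
      Finsupp.mapDomain_of_notMem_range α _ (by simp), zero_add]
  rw [DFunLike.ext_iff, Prod.forall, Fin.forall_fin_two]
  simp only [at_zero, at_one, DFunLike.ext_iff, Finsupp.curry_apply]

theorem coeff_rowIso_tmul (p q : Pol) (s : Fin 2 × Fin 2 →₀ ℕ) :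
    (rowIso (p ⊗ₜ q)).coeff s = p.coeff (s.curry 0) * q.coeff (s.curry 1) := by
  induction p using MvPolynomial.induction_on' with
  | add p₁ p₂ h₁ h₂ =>
    rw [TensorProduct.add_tmul, map_add, MvPolynomial.coeff_add, h₁, h₂, MvPolynomial.coeff_add,
      add_mul]
  | monomial α a =>
    induction q using MvPolynomial.induction_on' with
    | add q₁ q₂ h₁ h₂ =>
      rw [TensorProduct.tmul_add, map_add, MvPolynomial.coeff_add, h₁, h₂, MvPolynomial.coeff_add,
        mul_add]
    | monomial β b =>
      simp only [rowIso_tmul, MvPolynomial.rename_monomial, MvPolynomial.monomial_mul,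
        MvPolynomial.coeff_monomial, mapDomain_add_mapDomain_eq_iff, ite_zero_mul_ite_zero]

theorem rowIso_monomial_tmul (s : Fin 2 × Fin 2 →₀ ℕ) (a b : ℂ) :
    rowIso (MvPolynomial.monomial (s.curry 0) a ⊗ₜ MvPolynomial.monomial (s.curry 1) b) =
      MvPolynomial.monomial s (a * b) := by
  rw [rowIso_tmul, MvPolynomial.rename_monomial, MvPolynomial.rename_monomial,
    MvPolynomial.monomial_mul, mapDomain_add_mapDomain_eq_iff.2 ⟨rfl, rfl⟩]

theorem coeff_polE_self (i : Fin 2) (p : Pol) (α : Fin 2 →₀ ℕ) :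
    (polE i i p).coeff α = α i * p.coeff α := by
  induction p using MvPolynomial.induction_on' with
  | add p q hp hq => rw [map_add, MvPolynomial.coeff_add, hp, hq, MvPolynomial.coeff_add, mul_add]
  | monomial β b =>
    have euler : polE i i (MvPolynomial.monomial β b) = β i • MvPolynomial.monomial β b :=
      MvPolynomial.X_mul_pderiv_monomial
    rw [euler, MvPolynomial.coeff_smul, MvPolynomial.coeff_monomial]
    split_ifs with h
    · rw [h, nsmul_eq_mul]
    · rw [smul_zero, mul_zero]

theorem coeff_rowIso_tensorE (i : Fin 2) (x : Pol ⊗[ℂ] Pol) (s : Fin 2 × Fin 2 →₀ ℕ) :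
    (rowIso (tensorE i i x)).coeff s = (∑ a, s (a, i) : ℕ) * (rowIso x).coeff s := by
  induction x using TensorProduct.induction_on with
  | zero => simp only [map_zero, MvPolynomial.coeff_zero, mul_zero]
  | add x y hx hy => rw [map_add, map_add, map_add, MvPolynomial.coeff_add, hx, hy,
      MvPolynomial.coeff_add, mul_add]
  | tmul p q =>
    simp only [tensorE, LinearMap.add_apply, TensorProduct.map_tmul, LinearMap.id_apply, map_add,
      MvPolynomial.coeff_add, coeff_rowIso_tmul, coeff_polE_self, Finsupp.curry_apply,
      Fin.sum_univ_two, Nat.cast_add]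
    ring

theorem mem_eigenspace_tensorE_iff {i : Fin 2} {k : ℕ} {x : Pol ⊗[ℂ] Pol} :
    x ∈ Module.End.eigenspace (tensorE i i) (k : ℂ) ↔
      ∀ s ∈ (rowIso x).support, ∑ a, s (a, i) = k := by
  rw [Module.End.mem_eigenspace_iff, ← rowIso.injective.eq_iff, MvPolynomial.ext_iff]
  refine forall_congr' fun s => ?_
  rw [coeff_rowIso_tensorE, map_smul, MvPolynomial.coeff_smul, smul_eq_mul, mul_eq_mul_right_iff,
    Nat.cast_inj, MvPolynomial.mem_support_iff, or_iff_not_imp_right]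

theorem sum_eq_of_mem_irrep {p : Pol} {k : ℕ} (hp : p ∈ irrep k) {α : Fin 2 →₀ ℕ}
    (hα : p.coeff α ≠ 0) : ∑ i, α i = k := by
  rw [← Finsupp.degree_eq_sum]
  exact by_contra fun h => hα (((MvPolynomial.mem_homogeneousSubmodule k p).1 hp).coeff_eq_zero h)

theorem monomial_mem_irrep {k : ℕ} {α : Fin 2 →₀ ℕ} (hα : ∑ i, α i = k) (a : ℂ) :
    MvPolynomial.monomial α a ∈ irrep k :=
  (MvPolynomial.mem_homogeneousSubmodule k _).2
    (MvPolynomial.isHomogeneous_monomial a (by rw [Finsupp.degree_eq_sum, hα]))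

theorem mem_range_map_irrep_iff {m : Fin 2 → ℕ} {x : Pol ⊗[ℂ] Pol} :
    x ∈ LinearMap.range (TensorProduct.map (irrep (m 0)).subtype (irrep (m 1)).subtype) ↔
      ∀ s ∈ (rowIso x).support, ∀ a, ∑ i, s (a, i) = m a := by
  rw [show TensorProduct.map (irrep (m 0)).subtype (irrep (m 1)).subtype =
    TensorProduct.mapIncl (irrep (m 0)) (irrep (m 1)) from rfl, TensorProduct.range_mapIncl]
  constructor
  · intro hx
    suffices h : Submodule.map₂ (TensorProduct.mk ℂ Pol Pol) (irrep (m 0)) (irrep (m 1)) ≤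
        (MvPolynomial.restrictSupport ℂ {s | ∀ a, ∑ i, s (a, i) = m a}).comap
          rowIso.toLinearMap from h hx
    refine Submodule.map₂_le.2 fun p hp q hq s hs => ?_
    have hne : p.coeff (s.curry 0) * q.coeff (s.curry 1) ≠ 0 := by
      rw [← coeff_rowIso_tmul]
      exact MvPolynomial.mem_support_iff.1 hs
    exact Fin.forall_fin_two.2 ⟨sum_eq_of_mem_irrep hp (left_ne_zero_of_mul hne),
      sum_eq_of_mem_irrep hq (right_ne_zero_of_mul hne)⟩
  · intro h
    rw [← rowIso.symm_apply_apply x, (rowIso x).as_sum, map_sum]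
    refine Submodule.sum_mem _ fun s hs => ?_
    rw [← mul_one ((rowIso x).coeff s), ← rowIso_monomial_tmul, LinearEquiv.symm_apply_apply]
    exact Submodule.apply_mem_map₂ _ (monomial_mem_irrep (h s hs 0) _)
      (monomial_mem_irrep (h s hs 1) _)

/-- A `2 × 2` contingency table: the row sums of `s` are `m` and its column sums are `n`. The
monomials of this shape in the variables `x_{ai}` span the image of `(L_{m_1} ⊗ L_{m_2})[n]`
under `rowIso`. -/
def HasMargins (m n : Fin 2 → ℕ) (s : Fin 2 × Fin 2 →₀ ℕ) : Prop :=
  (∀ a, ∑ i, s (a, i) = m a) ∧ ∀ i, ∑ a, s (a, i) = n i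

theorem mem_weightSpace_iff {m n : Fin 2 → ℕ} {x : Pol ⊗[ℂ] Pol} :
    x ∈ weightSpace m n ↔ ∀ s ∈ (rowIso x).support, HasMargins m n s := by
  simp only [weightSpace, Submodule.mem_inf, mem_range_map_irrep_iff, Submodule.mem_iInf,
    mem_eigenspace_tensorE_iff, HasMargins, forall_and]
  exact and_congr_right fun _ => ⟨fun h s hs i => h i s hs, fun h i s hs => h s hs i⟩

theorem map_weightSpace_eq {F : (Pol ⊗[ℂ] Pol) ≃ₗ[ℂ] (Pol ⊗[ℂ] Pol)}
    {e : Fin 2 × Fin 2 ≃ Fin 2 × Fin 2}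
    (hF : ∀ x, rowIso (F x) = MvPolynomial.rename e (rowIso x)) {m n m' n' : Fin 2 → ℕ}
    (he : ∀ s, HasMargins m' n' (s.mapDomain e) ↔ HasMargins m n s) :
    (weightSpace m n).map F.toLinearMap = weightSpace m' n' := by
  ext y
  obtain ⟨x, rfl⟩ := F.surjective y
  rw [Submodule.mem_map_equiv, LinearEquiv.symm_apply_apply, mem_weightSpace_iff,
    mem_weightSpace_iff, hF, MvPolynomial.support_rename_of_injective e.injective,
    Finset.forall_mem_image]
  exact forall₂_congr fun s _ => (he s).symm

theorem rowIso_weylIso (x : Pol ⊗[ℂ] Pol) : rowIso (weylIso x) =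
    MvPolynomial.rename ((Equiv.refl (Fin 2)).prodCongr (Equiv.swap (0 : Fin 2) 1)) (rowIso x) := by
  induction x using TensorProduct.induction_on with
  | zero => simp only [map_zero]
  | add x y hx hy => simp only [map_add, hx, hy]
  | tmul p q =>
    simp only [weylIso, TensorProduct.congr_tmul, rowIso_tmul, map_mul,
      AlgEquiv.toLinearEquiv_apply, MvPolynomial.renameEquiv_apply, MvPolynomial.rename_rename]
    rfl

theorem rowIso_dualityIso (x : Pol ⊗[ℂ] Pol) : rowIso (dualityIso x) =
    MvPolynomial.rename (Equiv.prodComm (Fin 2) (Fin 2)) (rowIso x) := by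
  simp only [dualityIso, colIso, LinearEquiv.trans_apply, LinearEquiv.apply_symm_apply,
    AlgEquiv.toLinearEquiv_apply, MvPolynomial.renameEquiv_apply]

theorem map_weylIso_weightSpace (m n : Fin 2 → ℕ) :
    (weightSpace m n).map weylIso.toLinearMap = weightSpace m (swapPair n) := by
  refine map_weightSpace_eq rowIso_weylIso fun s => ?_
  simp only [HasMargins, Finsupp.mapDomain_equiv_apply]
  simp [swapPair, Fin.forall_fin_two, add_comm, and_comm]

theorem map_dualityIso_weightSpace (m n : Fin 2 → ℕ) :
    (weightSpace n m).map dualityIso.toLinearMap = weightSpace m n := by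
  refine map_weightSpace_eq rowIso_dualityIso fun s => ?_
  simp only [HasMargins, Finsupp.mapDomain_equiv_apply]
  simp [and_comm]

/-- The exponent of the monomial `E_{21}^{k-i} v_{m_1} ⊗ E_{21}^i v_{m_2}`, as a table. -/
noncomputable def loweredTable (m : Fin 2 → ℕ) (k i : ℕ) : Fin 2 × Fin 2 →₀ ℕ :=
  Finsupp.equivFunOnFinite.symm fun x => !![m 0 - (k - i), k - i; m 1 - i, i] x.1 x.2

theorem rowIso_lowered_tmul {m : Fin 2 → ℕ} {k i : ℕ} (h₀ : k - i ≤ m 0) (h₁ : i ≤ m 1) :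
    rowIso (lowered (m 0) (k - i) ⊗ₜ lowered (m 1) i) =
      MvPolynomial.monomial (loweredTable m k i) ((m 0).choose (k - i) * (m 1).choose i : ℂ) := by
  have monomial_eq {d j : ℕ} (hj : j ≤ d) {α : Fin 2 →₀ ℕ} (hα₀ : α 0 = d - j) (hα₁ : α 1 = j) :
      lowered d j = MvPolynomial.monomial α (d.choose j : ℂ) := by
    rw [lowered_eq hj, MvPolynomial.monomial_eq, Finsupp.prod_fintype _ _ fun i => pow_zero _,
      Fin.prod_univ_two, hα₀, hα₁, MvPolynomial.smul_eq_C_mul]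
  rw [← rowIso_monomial_tmul, monomial_eq h₀ (α := (loweredTable m k i).curry 0) rfl rfl,
    monomial_eq h₁ (α := (loweredTable m k i).curry 1) rfl rfl]

theorem betheSum_mem_weightSpace {m n : Fin 2 → ℕ} (hnm : n 0 + n 1 = m 0 + m 1) (c : ℕ → ℂ) :
    betheSum m (n 1) c ∈ weightSpace m n := by
  refine Submodule.sum_mem _ fun i hi => Submodule.smul_mem _ _ ?_
  rw [Finset.mem_Icc, le_min_iff] at hi
  rw [mem_weightSpace_iff, rowIso_lowered_tmul (by omega) (by omega)]
  intro s hs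
  obtain rfl := Finset.mem_singleton.1 (MvPolynomial.support_monomial_subset hs)
  simp only [HasMargins, loweredTable, Matrix.of_apply, Matrix.cons_val', Matrix.cons_val_fin_one,
    Finsupp.equivFunOnFinite_symm_apply_apply, Fin.sum_univ_two, Matrix.cons_val_zero,
    Matrix.cons_val_one, Fin.forall_fin_two]
  omega

theorem coeff_rowIso_betheSum {m : Fin 2 → ℕ} {k i : ℕ} (c : ℕ → ℂ)
    (hi : i ∈ Finset.Icc (k - m 0) (min (m 1) k)) :
    (rowIso (betheSum m k c)).coeff (loweredTable m k i) =
      c i * ((m 0).choose (k - i) * (m 1).choose i) := by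
  have coeff_term {j : ℕ} (hj : j ∈ Finset.Icc (k - m 0) (min (m 1) k)) :
      (rowIso (c j • (lowered (m 0) (k - j) ⊗ₜ[ℂ] lowered (m 1) j))).coeff (loweredTable m k i) =
        if j = i then c i * ((m 0).choose (k - i) * (m 1).choose i) else 0 := by
    rw [Finset.mem_Icc, le_min_iff] at hj
    have table_inj : loweredTable m k j = loweredTable m k i ↔ j = i :=
      ⟨fun h => DFunLike.congr_fun h (1, 1), fun h => h ▸ rfl⟩
    rw [map_smul, rowIso_lowered_tmul (by omega) (by omega), MvPolynomial.coeff_smul,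
      MvPolynomial.coeff_monomial, smul_eq_mul, mul_ite, mul_zero]
    simp only [table_inj]
    exact ite_congr rfl (fun h => h ▸ rfl) fun _ => rfl
  rw [betheSum, map_sum, MvPolynomial.coeff_sum, Finset.sum_congr rfl fun j => coeff_term,
    Finset.sum_ite_eq' _ i, if_pos hi]

theorem betheSum_ne_zero {m : Fin 2 → ℕ} {k i : ℕ} {c : ℕ → ℂ}
    (hi : i ∈ Finset.Icc (k - m 0) (min (m 1) k)) (hc : c i ≠ 0) : betheSum m k c ≠ 0 := by
  intro h
  have coeff_eq := coeff_rowIso_betheSum c hi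
  rw [h, map_zero, MvPolynomial.coeff_zero, eq_comm] at coeff_eq
  rw [Finset.mem_Icc, le_min_iff] at hi
  refine mul_ne_zero hc (mul_ne_zero ?_ ?_) coeff_eq <;>
    exact Nat.cast_ne_zero.2 (Nat.choose_pos (by omega)).ne'

theorem betheSum_congr {m : Fin 2 → ℕ} {k : ℕ} {c c' : ℕ → ℂ}
    (h : ∀ i ∈ Finset.Icc (k - m 0) (min (m 1) k), c i = c' i) :
    betheSum m k c = betheSum m k c' :=
  Finset.sum_congr rfl fun i hi => by rw [h i hi]

theorem betheSum_smul (m : Fin 2 → ℕ) (k : ℕ) (a : ℂ) (c : ℕ → ℂ) :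
    betheSum m k (fun i => a * c i) = a • betheSum m k c := by
  simp only [betheSum, Finset.smul_sum, smul_smul]

theorem weylIso_betheSum {m : Fin 2 → ℕ} {k k' : ℕ} (hk : k' + k = m 0 + m 1) (c : ℕ → ℂ) :
    weylIso (betheSum m k c) = betheSum m k' (fun i => c (m 1 - i)) := by
  rw [betheSum, map_sum, betheSum]
  refine Finset.sum_nbij' (m 1 - ·) (m 1 - ·) ?_ ?_ ?_ ?_ ?_ <;> intro i hi <;>
    simp only [Finset.mem_Icc, le_min_iff] at hi ⊢
  iterate 4 omega
  rw [map_smul, weylIso_formula (by omega) (by omega) (by omega), Nat.sub_sub_self (by omega),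
    show k' - (m 1 - i) = m 0 + i - k by omega]

theorem choose_mul_choose_dual {m n : Fin 2 → ℕ} (hnm : n 0 + n 1 = m 0 + m 1) {i : ℕ}
    (hn₀ : m 1 - i ≤ n 0) (hn₁ : i ≤ n 1) (hm₁ : i ≤ m 1) :
    ((n 0).choose (m 1 - i) * (n 1).choose i : ℂ) =
      ((n 0).factorial * (n 1).factorial) / ((m 0).factorial * (m 1).factorial) *
        ((m 0).choose (n 1 - i) * (m 1).choose i) := by
  have hf : ∀ j : ℕ, (j.factorial : ℂ) ≠ 0 := fun j => Nat.cast_ne_zero.2 j.factorial_ne_zero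
  rw [Nat.cast_choose ℂ hn₀, Nat.cast_choose ℂ hn₁, Nat.cast_choose ℂ hm₁,
    Nat.cast_choose ℂ (show n 1 - i ≤ m 0 by omega),
    show n 0 - (m 1 - i) = m 0 - (n 1 - i) by omega]
  field_simp [hf]

theorem dualityIso_lowered_tmul {m n : Fin 2 → ℕ} (hnm : n 0 + n 1 = m 0 + m 1) {i : ℕ}
    (hn₀ : m 1 - i ≤ n 0) (hn₁ : i ≤ n 1) (hm₁ : i ≤ m 1) :
    dualityIso (lowered (n 0) (m 1 - i) ⊗ₜ lowered (n 1) i) =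
      (((n 0).factorial * (n 1).factorial : ℂ) / ((m 0).factorial * (m 1).factorial)) •
        (lowered (m 0) (n 1 - i) ⊗ₜ lowered (m 1) i) := by
  have transpose : (loweredTable n (m 1) i).mapDomain (Equiv.prodComm (Fin 2) (Fin 2)) =
      loweredTable m (n 1) i := by
    ext ⟨a, j⟩
    rw [Finsupp.mapDomain_equiv_apply]
    fin_cases a <;> fin_cases j <;> simp [loweredTable]
    omega
  apply rowIso.injective
  rw [rowIso_dualityIso, rowIso_lowered_tmul hn₀ hn₁, MvPolynomial.rename_monomial, transpose,
    map_smul, rowIso_lowered_tmul (by omega) hm₁, MvPolynomial.smul_monomial, smul_eq_mul,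
    choose_mul_choose_dual hnm hn₀ hn₁ hm₁]

theorem dualityIso_betheSum {m n : Fin 2 → ℕ} (hnm : n 0 + n 1 = m 0 + m 1) (c : ℕ → ℂ) :
    dualityIso (betheSum n (m 1) c) =
      (((n 0).factorial * (n 1).factorial : ℂ) / ((m 0).factorial * (m 1).factorial)) •
        betheSum m (n 1) c := by
  have range_eq : Finset.Icc (m 1 - n 0) (min (n 1) (m 1)) =
      Finset.Icc (n 1 - m 0) (min (m 1) (n 1)) := by
    rw [min_comm, show m 1 - n 0 = n 1 - m 0 by omega]
  rw [betheSum, map_sum, betheSum, Finset.smul_sum, range_eq]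
  refine Finset.sum_congr rfl fun i hi => ?_
  rw [Finset.mem_Icc, le_min_iff] at hi
  rw [map_smul, dualityIso_lowered_tmul hnm (by omega) hi.2.2 hi.2.1, smul_comm]

/-! ### Wronskians and the Heun equations of a special space -/

theorem contDiff_of_mem_span_range {ι : Type*} {g : ι → ℂ → ℂ} {k : WithTop ℕ∞}
    (hg : ∀ i, ContDiff ℂ k (g i)) {f : ℂ → ℂ} (hf : f ∈ Submodule.span ℂ (Set.range g)) :
    ContDiff ℂ k f := by
  induction hf using Submodule.span_induction with
  | mem _ h =>
    obtain ⟨i, rfl⟩ := h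
    exact hg i
  | zero => exact contDiff_const
  | add _ _ _ _ h₁ h₂ => exact h₁.add h₂
  | smul a _ _ h => exact h.const_smul a

theorem functionWronskian_sum_smul {k : ℕ} (A : Matrix (Fin k) (Fin k) ℂ) {g : Fin k → ℂ → ℂ}
    (hg : ∀ j, ContDiff ℂ k (g j)) :
    functionWronskian (fun i => ∑ j, A i j • g j) = A.det • functionWronskian g := by
  ext x
  rw [Pi.smul_apply, functionWronskian, functionWronskian, smul_eq_mul, ← Matrix.det_mul]
  congr 1
  ext i j
  have hgj (r : Fin k) : ContDiffAt ℂ (j : ℕ) (g r) x :=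
    ((hg r).of_le (by exact_mod_cast j.is_lt.le)).contDiffAt
  simp only [Matrix.of_apply, Matrix.mul_apply]
  rw [iteratedDeriv_sum (f := fun r => A i r • g r) fun r _ => (hgj r).const_smul (A i r)]
  simp only [iteratedDeriv_const_smul_field, smul_eq_mul]

theorem functionWronskian_fin_one (f : Fin 1 → ℂ → ℂ) : functionWronskian f = f 0 := by
  ext x
  simp [functionWronskian]

theorem functionWronskian_fin_two (f : Fin 2 → ℂ → ℂ) :
    functionWronskian f = f 0 * deriv (f 1) - deriv (f 0) * f 1 := by
  ext x
  simp [functionWronskian, Matrix.det_fin_two]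

theorem le_analyticOrderAt_functionWronskian {f : Fin 2 → ℂ → ℂ} {w : ℂ} {k : ℕ}
    (hf : ∀ i, AnalyticAt ℂ (f i) w) (h : (k : ℕ∞) + 1 ≤ analyticOrderAt (f 0) w) :
    (k : ℕ∞) ≤ analyticOrderAt (functionWronskian f) w := by
  have hzero : f 0 w = 0 := apply_eq_zero_of_analyticOrderAt_ne_zero fun h0 => by simp [h0] at h
  rw [functionWronskian_fin_two]
  refine (le_min ?_ ?_).trans le_analyticOrderAt_sub
  · rw [analyticOrderAt_mul (hf 0) (hf 1).deriv]
    exact (le_self_add.trans h).trans le_self_add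
  · rw [analyticOrderAt_mul (hf 0).deriv (hf 1)]
    exact ((analyticOrderAt_deriv_ge_iff (hf 0) hzero).2 h).trans le_self_add

theorem le_analyticOrderAt_functionWronskian_of_mem_exponents {g : Fin 2 → ℂ → ℂ} {w : ℂ} {k : ℕ}
    (hg : ∀ i, ContDiff ℂ ⊤ (g i))
    (hk : k + 1 ∈ exponents (Submodule.span ℂ (Set.range g)) w) :
    (k : ℕ∞) ≤ analyticOrderAt (functionWronskian g) w := by
  obtain ⟨f, hf, hord⟩ := hk
  obtain ⟨a, rfl⟩ := (Submodule.mem_span_range_iff_exists_fun ℂ).1 hf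
  have ha : a ≠ 0 := by
    rintro rfl
    refine ENat.top_ne_natCast (k + 1) (hord ▸ (analyticOrderAt_eq_top.2 ?_).symm)
    simp
  obtain ⟨b, hdet⟩ : ∃ b : Fin 2 → ℂ, (Matrix.of ![a, b]).det ≠ 0 := by
    obtain ⟨i, hi⟩ := Function.ne_iff.1 ha
    fin_cases i
    · exact ⟨![0, 1], by simpa [Matrix.det_fin_two] using hi⟩
    · exact ⟨![1, 0], by simpa [Matrix.det_fin_two] using hi⟩
  set A : Matrix (Fin 2) (Fin 2) ℂ := Matrix.of ![a, b]
  have hcomb (i : Fin 2) : ContDiff ℂ ⊤ (∑ j, A i j • g j) :=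
    contDiff_of_mem_span_range hg ((Submodule.mem_span_range_iff_exists_fun ℂ).2 ⟨A i, rfl⟩)
  have hwr : functionWronskian g =
      (fun _ : ℂ => A.det⁻¹) • functionWronskian fun i => ∑ j, A i j • g j := by
    rw [functionWronskian_sum_smul A fun j => (hg j).of_le le_top]
    ext x
    simp [hdet]
  have han : AnalyticAt ℂ (functionWronskian fun i => ∑ j, A i j • g j) w := by
    rw [functionWronskian_fin_two]
    have (i : Fin 2) := (hcomb i).contDiffAt.analyticAt (x := w)
    exact ((this 0).mul (this 1).deriv).sub ((this 0).deriv.mul (this 1))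
  rw [hwr, analyticOrderAt_smul analyticAt_const han]
  exact (le_analyticOrderAt_functionWronskian (fun i => (hcomb i).contDiffAt.analyticAt)
    hord.ge).trans le_add_self

section QuasiPoly

variable (p : ℂ[X]) (μ : ℂ)

theorem hasDerivAt_quasiPoly (x : ℂ) :
    HasDerivAt (quasiPoly p μ) (quasiPoly (derivative p + C μ * p) μ x) x := by
  refine ((p.hasDerivAt x).mul ((hasDerivAt_id x).const_mul μ).cexp).congr_deriv ?_
  simp only [quasiPoly, eval_add, eval_mul, eval_C, id]
  ring

theorem deriv_quasiPoly : deriv (quasiPoly p μ) = quasiPoly (derivative p + C μ * p) μ :=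
  funext fun x => (hasDerivAt_quasiPoly p μ x).deriv

theorem contDiff_quasiPoly {k : WithTop ℕ∞} : ContDiff ℂ k (quasiPoly p μ) :=
  (p.contDiff_aeval k).mul (contDiff_const.mul contDiff_id).cexp

theorem X_sub_C_pow_dvd_iff_le_analyticOrderAt {w : ℂ} {k : ℕ} :
    (X - C w) ^ k ∣ p ↔ (k : ℕ∞) ≤ analyticOrderAt (quasiPoly p μ) w := by
  rcases eq_or_ne p 0 with rfl | hp
  · have : analyticOrderAt (quasiPoly 0 μ) w = ⊤ := analyticOrderAt_eq_top.2 (by simp [quasiPoly])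
    simp [this]
  obtain ⟨q, hpq, hq⟩ := exists_eq_pow_rootMultiplicity_mul_and_not_dvd p hp w
  have hord : analyticOrderAt (quasiPoly p μ) w = p.rootMultiplicity w := by
    refine ((contDiff_quasiPoly p μ).contDiffAt.analyticAt).analyticOrderAt_eq_natCast.2
      ⟨quasiPoly q μ, (contDiff_quasiPoly q μ).contDiffAt.analyticAt, ?_, .of_forall fun x => ?_⟩
    · rw [quasiPoly]
      exact mul_ne_zero (fun h => hq (dvd_iff_isRoot.2 h)) (Complex.exp_ne_zero _)
    · conv_lhs => rw [hpq]
      simp [quasiPoly, mul_assoc]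
  rw [hord, Nat.cast_le, le_rootMultiplicity_iff hp]

end QuasiPoly

/-- The polynomial factor of the Wronskian of `p₁ e^{l₁ x}` and `p₂ e^{l₂ x}`. -/
noncomputable def wronskianPoly (l : Fin 2 → ℂ) (p : Fin 2 → ℂ[X]) : ℂ[X] :=
  C (l 1 - l 0) * (p 0 * p 1) + wronskian (p 0) (p 1)

theorem functionWronskian_quasiPoly (l : Fin 2 → ℂ) (p : Fin 2 → ℂ[X]) :
    functionWronskian (fun i => quasiPoly (p i) (l i)) =
      quasiPoly (wronskianPoly l p) (l 0 + l 1) := by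
  ext x
  simp only [functionWronskian_fin_two, deriv_quasiPoly, Pi.sub_apply, Pi.mul_apply, quasiPoly,
    wronskianPoly, wronskian, eval_add, eval_sub, eval_mul, eval_C, add_mul, Complex.exp_add]
  ring

theorem natDegree_wronskianPoly_le (l : Fin 2 → ℂ) (p : Fin 2 → ℂ[X]) :
    (wronskianPoly l p).natDegree ≤ (p 0).natDegree + (p 1).natDegree := by
  have h' (a b : ℂ[X]) : (a * derivative b).natDegree ≤ a.natDegree + b.natDegree :=
    natDegree_mul_le.trans (by have := natDegree_derivative_le b; omega)
  refine natDegree_add_le_of_degree_le ((natDegree_C_mul_le _ _).trans natDegree_mul_le) ?_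
  refine (natDegree_sub_le _ _).trans (max_le (h' _ _) ?_)
  rw [mul_comm, add_comm]
  exact h' _ _

section Special

variable {l z : Fin 2 → ℂ} {n m : Fin 2 → ℕ} {p : Fin 2 → ℂ[X]}

theorem isCoprime_of_isSpecialSpace (hV : IsSpecialSpace l z n m (quasiSpace l p)) :
    IsCoprime (p 0) (p 1) := by
  rw [isCoprime_iff_aeval_ne_zero_of_isAlgClosed ℂ ℂ]
  intro x
  by_contra! hx
  simp only [coe_aeval_eq_eval] at hx
  obtain ⟨f, hf, hord⟩ : 0 ∈ exponents (quasiSpace l p) x := by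
    by_cases hxz : x ∈ Set.range z
    · obtain ⟨a, rfl⟩ := hxz
      simp [hV.exponents_z a]
    · simp [hV.exponents_regular x hxz]
  have hf_smooth : ContDiff ℂ ⊤ f := contDiff_of_mem_span_range (fun _ => contDiff_quasiPoly _ _) hf
  obtain ⟨a, rfl⟩ := (Submodule.mem_span_range_iff_exists_fun ℂ).1 hf
  refine analyticOrderAt_ne_zero.2 ⟨hf_smooth.contDiffAt.analyticAt, ?_⟩ hord
  simp [quasiPoly, hx]

theorem exists_wronskianPoly_eq (hnm : n 0 + n 1 = m 0 + m 1)
    (hp : ∀ i, (p i).degree = (n i : WithBot ℕ)) (hV : IsSpecialSpace l z n m (quasiSpace l p)) :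
    ∃ K : ℂ, wronskianPoly l p = C K * nodePowPoly z m := by
  have hdvd (a : Fin 2) : (X - C (z a)) ^ m a ∣ wronskianPoly l p := by
    rw [X_sub_C_pow_dvd_iff_le_analyticOrderAt _ (l 0 + l 1), ← functionWronskian_quasiPoly]
    exact le_analyticOrderAt_functionWronskian_of_mem_exponents
      (fun i => contDiff_quasiPoly _ _) (hV.exponents_z a ▸ by simp [add_comm])
  have hcop : IsCoprime ((X - C (z 0)) ^ m 0) ((X - C (z 1)) ^ m 1) :=
    (isCoprime_X_sub_C_of_isUnit_sub
      (sub_ne_zero.2 (hV.z_injective.ne (by decide))).isUnit).pow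
  have hmonic : (nodePowPoly z m).Monic := ((monic_X_sub_C _).pow _).mul ((monic_X_sub_C _).pow _)
  have hdeg : (wronskianPoly l p).natDegree ≤ (nodePowPoly z m).natDegree := by
    rw [nodePowPoly, ((monic_X_sub_C _).pow _).natDegree_mul ((monic_X_sub_C _).pow _),
      natDegree_pow, natDegree_pow, natDegree_X_sub_C, natDegree_X_sub_C, mul_one, mul_one, ← hnm,
      ← natDegree_eq_of_degree_eq_some (hp 0), ← natDegree_eq_of_degree_eq_some (hp 1)]
    exact natDegree_wronskianPoly_le l p
  exact ⟨_, eq_leadingCoeff_mul_of_monic_of_dvd_of_natDegree_le hmonic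
    (hcop.mul_dvd (hdvd 0) (hdvd 1)) hdeg⟩

theorem heunOp_sub_heunOp_of_wronskianPoly_eq (hnm : n 0 + n 1 = m 0 + m 1) {K : ℂ}
    (hK : wronskianPoly l p = C K * nodePowPoly z m) :
    p 0 * heunOp z m (l 1 - l 0) (n 1) (p 1) - p 1 * heunOp z m (l 0 - l 1) (n 0) (p 0) =
      C ((l 1 - l 0) * m 1 * (z 1 - z 0)) * (p 0 * p 1) := by
  have hlog : nodePoly z * derivative (wronskianPoly l p) = polarPoly z m * wronskianPoly l p := by
    rw [hK, derivative_C_mul]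
    linear_combination C K * nodePoly_mul_derivative_nodePowPoly z m
  have hn : (C (n 0 : ℂ) : ℂ[X]) + C (n 1 : ℂ) = C (m 0 : ℂ) + C (m 1 : ℂ) := by
    rw [← C_add, ← C_add]
    exact_mod_cast congrArg (fun k : ℕ => (C (k : ℂ) : ℂ[X])) hnm
  simp only [wronskianPoly, wronskian, polarPoly, derivative_add, derivative_sub, derivative_mul,
    derivative_C, C_sub] at hlog
  simp only [heunOp_apply, polarPoly, C_sub, C_mul]
  linear_combination hlog - (C (l 1) - C (l 0)) * (X - C (z 1)) * p 0 * p 1 * hn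

theorem exists_heunOp_eq_smul (hnm : n 0 + n 1 = m 0 + m 1)
    (hp : ∀ i, (p i).degree = (n i : WithBot ℕ)) (hV : IsSpecialSpace l z n m (quasiSpace l p)) :
    ∃ E : ℂ, heunOp z m (l 1 - l 0) (n 1) (p 1) = E • p 1 ∧
      heunOp z m (l 0 - l 1) (n 0) (p 0) = (E - (l 1 - l 0) * m 1 * (z 1 - z 0)) • p 0 := by
  obtain ⟨K, hK⟩ := exists_wronskianPoly_eq hnm hp hV
  have hkey := heunOp_sub_heunOp_of_wronskianPoly_eq hnm hK
  have hp1 : p 1 ≠ 0 := fun h => by simpa [h] using hp 1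
  obtain ⟨h, hh⟩ : p 1 ∣ heunOp z m (l 1 - l 0) (n 1) (p 1) :=
    (isCoprime_of_isSpecialSpace hV).symm.dvd_of_dvd_mul_left
      ⟨heunOp z m (l 0 - l 1) (n 0) (p 0) + C ((l 1 - l 0) * m 1 * (z 1 - z 0)) * p 0,
        by linear_combination hkey⟩
  have hdeg : (p 1).natDegree = n 1 := natDegree_eq_of_degree_eq_some (hp 1)
  obtain ⟨E, rfl⟩ : ∃ E, h = C E := by
    refine ⟨_, eq_C_of_natDegree_eq_zero ?_⟩
    rcases eq_or_ne h 0 with rfl | h0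
    · exact natDegree_zero
    · have hle := natDegree_heunOp_le (y := z) (M := m) (δ := l 1 - l 0) hdeg.le
      rw [hh, natDegree_mul hp1 h0, hdeg] at hle
      omega
  refine ⟨E, by rw [hh, smul_eq_C_mul, mul_comm], mul_left_cancel₀ hp1 ?_⟩
  rw [smul_eq_C_mul, C_sub]
  linear_combination p 0 * hh - hkey

end Special

/-! ### The bispectral dual -/

section LaplaceTransform

theorem hasDerivAt_intervalIntegral_of_continuous {E : Type*} [NormedAddCommGroup E]
    [NormedSpace ℂ E] {F F' : ℂ → ℝ → E} {a b : ℝ} (hF : ∀ v, Continuous (F v))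
    (hF' : Continuous fun x : ℂ × ℝ => F' x.1 x.2)
    (hd : ∀ v θ, HasDerivAt (fun v => F v θ) (F' v θ) v) (u : ℂ) :
    HasDerivAt (fun v => ∫ θ in a..b, F v θ) (∫ θ in a..b, F' u θ) u := by
  obtain ⟨B, hB⟩ := ((isCompact_closedBall u 1).prod (isCompact_uIcc (a := a) (b := b)))
    |>.exists_bound_of_continuousOn hF'.continuousOn
  refine (intervalIntegral.hasDerivAt_integral_of_dominated_loc_of_deriv_le (bound := fun _ => B)
    (Metric.closedBall_mem_nhds u one_pos) (.of_forall fun v => (hF v).aestronglyMeasurable)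
    ((hF u).intervalIntegrable _ _) ?_ (.of_forall fun θ hθ v hv => ?_) intervalIntegrable_const
    (.of_forall fun θ _ v _ => hd v θ)).2
  · exact (hF'.comp (Continuous.prodMk_right u)).aestronglyMeasurable
  · exact hB (v, θ) ⟨hv, Set.uIoc_subset_uIcc hθ⟩

variable {φ : ℂ → ℂ} {c : ℂ} {r : ℝ}

theorem hasDerivAt_circleIntegral_exp_mul (hr : 0 ≤ r)
    (hφ : ContinuousOn φ (Metric.sphere c r)) (u : ℂ) :
    HasDerivAt (fun u => ∮ x in C(c, r), Complex.exp (u * x) * φ x)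
      (∮ x in C(c, r), Complex.exp (u * x) * (x * φ x)) u := by
  have hcm : Continuous fun θ => φ (circleMap c r θ) :=
    hφ.comp_continuous (continuous_circleMap c r) fun θ => circleMap_mem_sphere c hr θ
  simp only [circleIntegral, deriv_circleMap]
  refine hasDerivAt_intervalIntegral_of_continuous
    (F := fun v θ => (circleMap 0 r θ * Complex.I) •
      (Complex.exp (v * circleMap c r θ) * φ (circleMap c r θ)))
    (F' := fun v θ => (circleMap 0 r θ * Complex.I) •
      (Complex.exp (v * circleMap c r θ) * (circleMap c r θ * φ (circleMap c r θ))))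
    (fun v => ?_) ?_ (fun v θ => ?_) u
  · exact .smul (f := fun θ => circleMap 0 r θ * Complex.I) (by fun_prop) (.mul (by fun_prop) hcm)
  · have hcm' : Continuous fun q : ℂ × ℝ => φ (circleMap c r q.2) := hcm.comp continuous_snd
    exact .smul (f := fun q : ℂ × ℝ => circleMap 0 r q.2 * Complex.I) (by fun_prop)
      (.mul (by fun_prop) (.mul (by fun_prop) hcm'))
  · refine ((((hasDerivAt_id v).mul_const (circleMap c r θ)).cexp.mul_const
      (φ (circleMap c r θ))).const_smul (circleMap 0 r θ * Complex.I)).congr_deriv ?_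
    simp only [id, one_mul, mul_assoc]

theorem iteratedDeriv_circleIntegral_exp_mul (hr : 0 ≤ r)
    (hφ : ContinuousOn φ (Metric.sphere c r)) (i : ℕ) :
    iteratedDeriv i (fun u => ∮ x in C(c, r), Complex.exp (u * x) * φ x) =
      fun u => ∮ x in C(c, r), Complex.exp (u * x) * (x ^ i * φ x) := by
  induction i with
  | zero => simp
  | succ i ih =>
    ext u
    have hφi : ContinuousOn (fun x => x ^ i * φ x) (Metric.sphere c r) := by fun_prop
    simp only [iteratedDeriv_succ, ih, (hasDerivAt_circleIntegral_exp_mul hr hφi u).deriv,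
      pow_succ', mul_assoc]

end LaplaceTransform

section Kernel

variable {a b : ℕ}

/-- The coefficient of `∂ ^ j` in the differential operator `∑ Q i j * x ^ i * ∂ ^ j`. -/
noncomputable def kernelCoeff (Q : Matrix (Fin a) (Fin b) ℂ) (j : Fin b) : ℂ[X] :=
  ∑ i, C (Q i j) * X ^ (i : ℕ)

theorem eval_kernelCoeff (Q : Matrix (Fin a) (Fin b) ℂ) (j : Fin b) (x : ℂ) :
    (kernelCoeff Q j).eval x = ∑ i, Q i j * x ^ (i : ℕ) := by
  simp [kernelCoeff, eval_finsetSum]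

/-- The entire functions annihilated by the differential operator `∑ Q i j * x ^ i * ∂ ^ j`.
Transposing `Q` interchanges the roles of `x` and `∂`, which is the bispectral duality. -/
def kernelSolutions (Q : Matrix (Fin a) (Fin b) ℂ) : Submodule ℂ (ℂ → ℂ) where
  carrier := {f | Differentiable ℂ f ∧
    ∀ x, ∑ j, (kernelCoeff Q j).eval x * iteratedDeriv j f x = 0}
  zero_mem' := ⟨differentiable_const 0, fun x => by simp [iteratedDeriv_const_zero]⟩
  add_mem' := fun ⟨hf, hf'⟩ ⟨hg, hg'⟩ => ⟨hf.add hg, fun x => by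
    simp only [iteratedDeriv_add hf.contDiff.contDiffAt hg.contDiff.contDiffAt, mul_add,
      Finset.sum_add_distrib, hf' x, hg' x, add_zero]⟩
  smul_mem' := fun k f ⟨hf, hf'⟩ => ⟨hf.const_smul k, fun x => by
    simp only [iteratedDeriv_const_smul_field, smul_eq_mul, mul_left_comm _ k, ← Finset.mul_sum,
      hf' x, mul_zero]⟩

variable {φ : ℂ → ℂ} {c : ℂ} {r : ℝ}

theorem circleIntegral_exp_mul_mem_kernelSolutions_transpose {Q : Matrix (Fin a) (Fin b) ℂ}
    (hr : 0 ≤ r) (hφ : ContinuousOn φ (Metric.sphere c r))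
    (hQ : ∀ u, (∮ x in C(c, r),
      Complex.exp (u * x) * ((∑ j, (kernelCoeff Q j).eval x * u ^ (j : ℕ)) * φ x)) = 0) :
    (fun u => ∮ x in C(c, r), Complex.exp (u * x) * φ x) ∈ kernelSolutions Q.transpose := by
  refine ⟨fun u => (hasDerivAt_circleIntegral_exp_mul hr hφ u).differentiableAt, fun u => ?_⟩
  have hint (i : Fin a) : CircleIntegrable (fun x => (kernelCoeff Q.transpose i).eval u *
      (Complex.exp (u * x) * (x ^ (i : ℕ) * φ x))) c r :=
    ContinuousOn.circleIntegrable hr (by fun_prop)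
  simp only [iteratedDeriv_circleIntegral_exp_mul hr hφ, ← circleIntegral.integral_const_mul]
  rw [← circleIntegral.integral_fun_sum fun i _ => hint i, ← hQ u]
  refine congrArg (circleIntegral · c r) (funext fun x => ?_)
  simp only [eval_kernelCoeff, Matrix.transpose_apply, Finset.sum_mul, Finset.mul_sum]
  rw [Finset.sum_comm]
  refine Finset.sum_congr rfl fun j _ => Finset.sum_congr rfl fun i _ => ?_
  ring

/- If `W` satisfies the differential equation of the Wronskian, then `f / (a₂ W)` solves the adjoint
equation, so that `exp (u * x)` times the symbol times `f / (a₂ W)` is a derivative. -/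
theorem circleIntegral_exp_mul_div_mem_kernelSolutions_transpose
    {Q : Matrix (Fin a) (Fin 3) ℂ} {f W W' : ℂ → ℂ} (hf : f ∈ kernelSolutions Q) (hr : 0 ≤ r)
    (hQ : ∀ x ∈ Metric.sphere c r, (kernelCoeff Q 2).eval x ≠ 0)
    (hW : ∀ x ∈ Metric.sphere c r, W x ≠ 0)
    (hW' : ∀ x ∈ Metric.sphere c r, HasDerivAt W (W' x) x)
    (hWr : ∀ x ∈ Metric.sphere c r,
      (kernelCoeff Q 2).eval x * W' x = -((kernelCoeff Q 1).eval x * W x)) :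
    (fun u => ∮ x in C(c, r), Complex.exp (u * x) * (f x / ((kernelCoeff Q 2).eval x * W x))) ∈
      kernelSolutions Q.transpose := by
  obtain ⟨hdiff, hode⟩ := hf
  have hcont : ContinuousOn W (Metric.sphere c r) := fun x hx =>
    (hW' x hx).continuousAt.continuousWithinAt
  refine circleIntegral_exp_mul_mem_kernelSolutions_transpose hr
    (hdiff.continuous.continuousOn.div ((Polynomial.continuous _).continuousOn.mul hcont)
      fun x hx => mul_ne_zero (hQ x hx) (hW x hx)) fun u => ?_
  refine circleIntegral.integral_eq_zero_of_hasDerivWithinAt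
    (f := fun x => Complex.exp (u * x) * (u * f x - deriv f x) / W x) hr fun x hx => ?_
  have hf' : HasDerivAt f (deriv f x) x := (hdiff x).hasDerivAt
  have hf'' : HasDerivAt (deriv f) (deriv (deriv f) x) x :=
    (hdiff.contDiff (n := 2)).differentiable_deriv_two.differentiableAt.hasDerivAt
  have hexp : HasDerivAt (fun x => Complex.exp (u * x)) (Complex.exp (u * x) * u) x := by
    simpa using ((hasDerivAt_id x).const_mul u).cexp
  refine (((hexp.mul ((hf'.const_mul u).sub hf'')).div (hW' x hx)
    (hW x hx)).congr_deriv ?_).hasDerivWithinAt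
  have ha := hQ x hx
  have hW0 := hW x hx
  have hode := hode x
  simp only [Fin.sum_univ_three, Fin.val_zero, Fin.val_one, Fin.val_two, iteratedDeriv_zero,
    iteratedDeriv_succ, Pi.mul_apply, Pi.sub_apply] at hode ⊢
  field_simp
  linear_combination -(u * f x - deriv f x) * hWr x hx - W x * hode

end Kernel

/-- The coefficients of `x ^ i * u ^ j` in the kernel
`(x - z₁) (x - z₂) (u - l₁) (u - l₂) - (m₁ (x - z₂) + m₂ (x - z₁)) (u - l₂)
- (l₂ - l₁) n₂ (x - z₂) - E`, whose two differential operators govern `V` and its dual. -/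
def heunKernel (l z : Fin 2 → ℂ) (n m : Fin 2 → ℕ) (E : ℂ) : Matrix (Fin 3) (Fin 3) ℂ :=
  Matrix.vecMulVec ![z 0 * z 1, -(z 0 + z 1), 1] ![l 0 * l 1, -(l 0 + l 1), 1] -
    Matrix.vecMulVec ![-(m 0 * z 1 + m 1 * z 0), m 0 + m 1, 0] ![-l 1, 1, 0] -
    Matrix.vecMulVec ![E - (l 1 - l 0) * n 1 * z 1, (l 1 - l 0) * n 1, 0] ![1, 0, 0]

section HeunKernel

variable (l z : Fin 2 → ℂ) (n m : Fin 2 → ℕ) (E : ℂ)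

variable {n m} in
theorem heunKernel_transpose (hnm : n 0 + n 1 = m 0 + m 1) :
    (heunKernel l z n m E).transpose = heunKernel z l m n E := by
  have hn : (n 0 : ℂ) = m 0 + m 1 - n 1 := by
    rw [eq_sub_iff_add_eq]
    exact_mod_cast hnm
  ext i j
  fin_cases i <;> fin_cases j <;> simp [heunKernel, hn] <;> ring

theorem kernelCoeff_heunKernel_zero : kernelCoeff (heunKernel l z n m E) 0 =
    C (l 0 * l 1) * nodePoly z + C (l 1) * polarPoly z m -
      C ((l 1 - l 0) * n 1) * (X - C (z 1)) - C E := by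
  simp only [kernelCoeff, heunKernel, Matrix.sub_apply, Matrix.vecMulVec_apply, Fin.sum_univ_three,
    Matrix.cons_val, Fin.val_zero, Fin.val_one, Fin.val_two, nodePoly, polarPoly, map_sub, map_add,
    map_mul, map_neg, map_natCast, map_one, map_zero]
  ring

theorem kernelCoeff_heunKernel_one : kernelCoeff (heunKernel l z n m E) 1 =
    -(C (l 0 + l 1) * nodePoly z + polarPoly z m) := by
  simp only [kernelCoeff, heunKernel, Matrix.sub_apply, Matrix.vecMulVec_apply, Fin.sum_univ_three,
    Matrix.cons_val, Fin.val_zero, Fin.val_one, Fin.val_two, nodePoly, polarPoly, map_sub, map_add,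
    map_mul, map_neg, map_natCast, map_one, map_zero]
  ring

theorem kernelCoeff_heunKernel_two : kernelCoeff (heunKernel l z n m E) 2 = nodePoly z := by
  simp only [kernelCoeff, heunKernel, Matrix.sub_apply, Matrix.vecMulVec_apply, Fin.sum_univ_three,
    Matrix.cons_val, Fin.val_zero, Fin.val_one, Fin.val_two, nodePoly, map_sub, map_add,
    map_mul, map_neg, map_natCast, map_one, map_zero]
  ring

theorem quasiPoly_mem_kernelSolutions_iff {b : ℕ} {Q : Matrix (Fin b) (Fin 3) ℂ} {p : ℂ[X]}
    {μ : ℂ} :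
    quasiPoly p μ ∈ kernelSolutions Q ↔
      kernelCoeff Q 0 * p + kernelCoeff Q 1 * (derivative p + C μ * p) +
        kernelCoeff Q 2 * (derivative (derivative p + C μ * p) + C μ * (derivative p + C μ * p)) =
          0 := by
  have hiter : ∀ x, ∑ j, (kernelCoeff Q j).eval x * iteratedDeriv j (quasiPoly p μ) x =
      quasiPoly (kernelCoeff Q 0 * p + kernelCoeff Q 1 * (derivative p + C μ * p) +
        kernelCoeff Q 2 * (derivative (derivative p + C μ * p) +
          C μ * (derivative p + C μ * p))) μ x := fun x => by
    simp only [Fin.sum_univ_three, Fin.val_zero, Fin.val_one, Fin.val_two, iteratedDeriv_zero,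
      iteratedDeriv_succ, deriv_quasiPoly]
    simp only [quasiPoly, eval_add, eval_mul]
    ring
  constructor
  · rintro ⟨-, h⟩
    refine Polynomial.funext fun x => ?_
    have hx := h x
    rw [hiter] at hx
    simpa [quasiPoly, Complex.exp_ne_zero] using hx
  · refine fun h => ⟨(contDiff_quasiPoly p μ (k := 1)).differentiable one_ne_zero, fun x => ?_⟩
    rw [hiter, h]
    simp [quasiPoly]

variable {l z E}

theorem quasiPoly_one_mem_kernelSolutions_iff {p : ℂ[X]} :
    quasiPoly p (l 1) ∈ kernelSolutions (heunKernel l z n m E) ↔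
      heunOp z m (l 1 - l 0) (n 1) p = E • p := by
  rw [quasiPoly_mem_kernelSolutions_iff, ← sub_eq_zero (b := E • p), kernelCoeff_heunKernel_zero,
    kernelCoeff_heunKernel_one, kernelCoeff_heunKernel_two, heunOp_apply, smul_eq_C_mul]
  simp only [derivative_add, derivative_C_mul, C_add, C_sub, C_mul]
  ring_nf

variable {n m}

theorem quasiPoly_zero_mem_kernelSolutions_iff (hnm : n 0 + n 1 = m 0 + m 1) {p : ℂ[X]} :
    quasiPoly p (l 0) ∈ kernelSolutions (heunKernel l z n m E) ↔
      heunOp z m (l 0 - l 1) (n 0) p = (E - (l 1 - l 0) * m 1 * (z 1 - z 0)) • p := by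
  have hn : (n 0 : ℂ) = m 0 + m 1 - n 1 := by
    rw [eq_sub_iff_add_eq]
    exact_mod_cast hnm
  rw [quasiPoly_mem_kernelSolutions_iff, ← sub_eq_zero (b := _ • p), kernelCoeff_heunKernel_zero,
    kernelCoeff_heunKernel_one, kernelCoeff_heunKernel_two, heunOp_apply, smul_eq_C_mul, hn,
    polarPoly]
  simp only [derivative_add, derivative_C_mul, C_add, C_sub, C_mul]
  ring_nf

end HeunKernel

theorem conjugateSpace_two_le_map {g : Fin 2 → ℂ → ℂ} (hg : ∀ i, ContDiff ℂ 2 (g i)) {W : ℂ → ℂ}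
    {K : ℂ} (hW : functionWronskian g = K • W) :
    conjugateSpace 2 (Submodule.span ℂ (Set.range g)) ≤
      (Submodule.span ℂ (Set.range g)).map (LinearMap.mulLeft ℂ W⁻¹) := by
  refine Submodule.span_le.2 ?_
  rintro _ ⟨b, -, hspan, f, hf, rfl⟩
  choose A hA using fun i => (Submodule.mem_span_range_iff_exists_fun ℂ).1
    (hspan ▸ Submodule.subset_span (Set.mem_range_self i) : b i ∈ Submodule.span ℂ (Set.range g))
  refine ⟨((Matrix.of A).det * K)⁻¹ • f 0, Submodule.smul_mem _ _ (hf 0), ?_⟩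
  have hb : functionWronskian b = ((Matrix.of A).det * K) • W := by
    rw [mul_smul, ← hW, ← functionWronskian_sum_smul (Matrix.of A) hg]
    exact congrArg functionWronskian (funext fun i => (hA i).symm)
  ext x
  simp only [LinearMap.mulLeft_apply, hb, functionWronskian_fin_one, Pi.mul_apply, Pi.inv_apply,
    Pi.smul_apply, smul_eq_mul]
  rw [div_eq_mul_inv, mul_inv]
  ring

theorem eventually_sphere_avoids_range {ι : Type*} [Finite ι] (z : ι → ℂ) (c : ℂ) :
    ∀ᶠ r : ℝ in nhdsWithin 0 (Set.Ioi 0), ∀ x ∈ Metric.sphere c r, ∀ b, x ≠ z b := by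
  have havoid (d : ℝ) : ∀ᶠ r : ℝ in nhdsWithin 0 (Set.Ioi 0), d ≠ r := by
    rcases le_or_gt d 0 with hd | hd
    · exact eventually_mem_nhdsWithin.mono fun r hr => (hd.trans_lt hr).ne
    · exact Filter.mem_of_superset (Ioo_mem_nhdsGT hd) fun r hr => hr.2.ne'
  filter_upwards [Filter.eventually_all.2 fun b => havoid (dist (z b) c)] with r hr x hx b hxb
  exact hr b (hxb ▸ hx)

section SpecialDual

variable {l z : Fin 2 → ℂ} {n m : Fin 2 → ℕ} {p : Fin 2 → ℂ[X]}

theorem quasiSpace_le_kernelSolutions (hnm : n 0 + n 1 = m 0 + m 1) {E : ℂ}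
    (h₁ : heunOp z m (l 1 - l 0) (n 1) (p 1) = E • p 1)
    (h₀ : heunOp z m (l 0 - l 1) (n 0) (p 0) = (E - (l 1 - l 0) * m 1 * (z 1 - z 0)) • p 0) :
    quasiSpace l p ≤ kernelSolutions (heunKernel l z n m E) := by
  refine Submodule.span_le.2 (Set.range_subset_iff.2 fun i => ?_)
  fin_cases i
  · exact (quasiPoly_zero_mem_kernelSolutions_iff hnm).2 h₀
  · exact (quasiPoly_one_mem_kernelSolutions_iff n m).2 h₁

theorem specialDual_le_kernelSolutions_transpose {V : Submodule ℂ (ℂ → ℂ)} {E : ℂ}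
    (hV : V ≤ kernelSolutions (heunKernel l z n m E))
    (hconj : conjugateSpace 2 V ≤
      V.map (LinearMap.mulLeft ℂ (quasiPoly (nodePowPoly z m) (l 0 + l 1))⁻¹)) :
    specialDual 2 z V ≤ kernelSolutions (heunKernel l z n m E).transpose := by
  refine Submodule.span_le.2 ?_
  rintro g ⟨a, ψ, hψ, hg⟩
  obtain ⟨f, hf, rfl⟩ := hconj hψ
  obtain ⟨r, hr, hr0, hz⟩ :=
    (hg.and (eventually_mem_nhdsWithin.and (eventually_sphere_avoids_range z (z a)))).exists
  have hQ := kernelCoeff_heunKernel_two l z n m E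
  have hgf : g = fun u => ∮ x in C(z a, r), Complex.exp (u * x) *
      (f x / ((kernelCoeff (heunKernel l z n m E) 2).eval x *
        quasiPoly (nodePowPoly z m) (l 0 + l 1) x)) := by
    ext u
    rw [hr u]
    refine congrArg (circleIntegral · (z a) r) (funext fun x => ?_)
    simp only [hQ, nodePoly, Fin.prod_univ_two, eval_mul, eval_sub, eval_X, eval_C,
      LinearMap.mulLeft_apply, Pi.mul_apply, Pi.inv_apply, div_eq_mul_inv, mul_inv]
    ring
  rw [SetLike.mem_coe, hgf]
  refine circleIntegral_exp_mul_div_mem_kernelSolutions_transpose (hV hf) hr0.le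
    (fun x hx => hQ ▸ eval_nodePoly_ne_zero (hz x hx))
    (fun x hx => mul_ne_zero (eval_nodePowPoly_ne_zero (hz x hx) m) (Complex.exp_ne_zero _))
    (fun x _ => hasDerivAt_quasiPoly _ _ x) fun x _ => ?_
  have h := congrArg (eval x) (nodePoly_mul_derivative_nodePowPoly z m)
  rw [hQ, kernelCoeff_heunKernel_one]
  simp only [quasiPoly, eval_mul, eval_add, eval_neg, eval_C] at h ⊢
  linear_combination Complex.exp ((l 0 + l 1) * x) * h

theorem exists_heunOp_eq_smul_of_specialDual (hnm : n 0 + n 1 = m 0 + m 1)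
    (hp : ∀ i, (p i).degree = (n i : WithBot ℕ)) (hV : IsSpecialSpace l z n m (quasiSpace l p))
    {q : ℂ[X]} (hq : quasiPoly q (z 1) ∈ specialDual 2 z (quasiSpace l p)) :
    ∃ E : ℂ, heunOp z m (l 1 - l 0) (n 1) (p 1) = E • p 1 ∧
      heunOp z m (l 0 - l 1) (n 0) (p 0) = (E - (l 1 - l 0) * m 1 * (z 1 - z 0)) • p 0 ∧
      heunOp l n (z 1 - z 0) (m 1) q = E • q := by
  obtain ⟨E, h₁, h₀⟩ := exists_heunOp_eq_smul hnm hp hV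
  obtain ⟨K, hK⟩ := exists_wronskianPoly_eq hnm hp hV
  have hwr : functionWronskian (fun i => quasiPoly (p i) (l i)) =
      K • quasiPoly (nodePowPoly z m) (l 0 + l 1) := by
    ext x
    simp [functionWronskian_quasiPoly, hK, quasiPoly, mul_assoc]
  have hqE := specialDual_le_kernelSolutions_transpose (quasiSpace_le_kernelSolutions hnm h₁ h₀)
    (conjugateSpace_two_le_map (fun _ => contDiff_quasiPoly _ _) hwr) hq
  rw [heunKernel_transpose l z E hnm, quasiPoly_one_mem_kernelSolutions_iff] at hqE
  exact ⟨E, h₁, h₀, hqE⟩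

end SpecialDual

/-! ### Bethe vectors -/

section SpanSingleton

variable {K E : Type*} [Field K] [AddCommGroup E] [Module K E] {v x y : E}

theorem apply_mem_span_singleton {E' F : Type*} [AddCommGroup E'] [Module K E'] [FunLike F E E']
    [LinearMapClass F K E E'] (f : F) (hx : x ∈ K ∙ v) : f x ∈ K ∙ f v := by
  obtain ⟨a, rfl⟩ := Submodule.mem_span_singleton.1 hx
  exact Submodule.mem_span_singleton.2 ⟨a, (map_smul f a v).symm⟩

theorem exists_eq_smul_of_mem_span_singleton (hx : x ∈ K ∙ v) (hy : y ∈ K ∙ v) (hx₀ : x ≠ 0)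
    (hy₀ : y ≠ 0) : ∃ κ : K, κ ≠ 0 ∧ x = κ • y := by
  obtain ⟨a, rfl⟩ := Submodule.mem_span_singleton.1 hx
  obtain ⟨b, rfl⟩ := Submodule.mem_span_singleton.1 hy
  have ha := left_ne_zero_of_smul hx₀
  have hb := left_ne_zero_of_smul hy₀
  exact ⟨a / b, div_ne_zero ha hb, by rw [smul_smul, div_mul_cancel₀ a hb]⟩

end SpanSingleton

section BetheVectors

variable {y : Fin 2 → ℂ} {M : Fin 2 → ℕ} {k : ℕ} {c : ℕ → ℂ}

theorem betheSum_ne_zero_of_coeff_ne_zero (hk : k ≤ M 0 + M 1) (hc : c (k - M 0) ≠ 0) :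
    betheSum M k c ≠ 0 :=
  betheSum_ne_zero (Finset.mem_Icc.2 ⟨le_rfl, by omega⟩) hc

theorem eval_ne_zero_of_represents {p : ℂ[X]} {t : Fin k → ℂ} (hp : Represents p t)
    (ht : IsAdmissible y t) (a : Fin 2) : p.eval (y a) ≠ 0 := by
  obtain ⟨b, hb, rfl⟩ := hp
  simp only [eval_mul, eval_C, eval_prod, eval_sub, eval_X]
  exact mul_ne_zero hb (Finset.prod_ne_zero_iff.2 fun j _ => sub_ne_zero.2 (ht.2 j a).symm)

theorem exists_universalVector_eq_smul (M : Fin 2 → ℕ) (hy : y 0 ≠ y 1) {t : Fin k → ℂ}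
    (hp : Represents (twoPointPoly y k c) t) (ht : IsAdmissible y t) :
    ∃ κ : ℂ, κ ≠ 0 ∧ universalVector y M t = κ • betheSum M k (fun i => (-1) ^ i * c i) := by
  obtain ⟨κ, hκ, h⟩ := exists_betheCoeff_eq_smul hy hp ht
  refine ⟨κ, hκ, ?_⟩
  rw [universalVector, ← betheSum_smul]
  exact betheSum_congr fun i hi => h i ((Finset.mem_Icc.1 hi).2.trans (min_le_right _ _))

theorem universalVector_mem_span (M : Fin 2 → ℕ) (hy : y 0 ≠ y 1) {t : Fin k → ℂ}
    (hp : Represents (twoPointPoly y k c) t) (ht : IsAdmissible y t) :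
    universalVector y M t ∈ ℂ ∙ betheSum M k (fun i => (-1) ^ i * c i) := by
  obtain ⟨κ, -, h⟩ := exists_universalVector_eq_smul M hy hp ht
  exact Submodule.mem_span_singleton.2 ⟨κ, h.symm⟩

theorem isCriticalPoint_and_universalVector {l : Fin 2 → ℂ} {E : ℂ} (hl : l 0 ≠ l 1)
    (hy : y 0 ≠ y 1) (hk : k ≤ M 0 + M 1)
    (h : heunOp y M (l 1 - l 0) k (twoPointPoly y k c) = E • twoPointPoly y k c) {t : Fin k → ℂ}
    (hp : Represents (twoPointPoly y k c) t) (ht : IsAdmissible y t) :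
    IsCriticalPoint l y M t ∧ universalVector y M t ≠ 0 ∧
      ∃ κ : ℂ, κ ≠ 0 ∧ universalVector y M t = κ • betheSum M k (fun i => (-1) ^ i * c i) := by
  obtain ⟨κ, hκ, hω⟩ := exists_universalVector_eq_smul M hy hp ht
  refine ⟨isCriticalPoint_of_heunOp_eq_smul h hp ht, hω ▸ smul_ne_zero hκ ?_, κ, hκ, hω⟩
  exact betheSum_ne_zero_of_coeff_ne_zero hk <| mul_ne_zero (pow_ne_zero _ (by norm_num))
    (coeff_ne_zero_of_eval_ne_zero hy (sub_ne_zero.2 hl.symm) h (eval_ne_zero_of_represents hp ht))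

end BetheVectors

section CommonLine

variable {l z : Fin 2 → ℂ} {n m : Fin 2 → ℕ} {k : ℕ} {E ε σ : ℂ} {c d e x : ℕ → ℂ}

theorem reverse_mem_blockSolutions (hnm : n 0 + n 1 = m 0 + m 1)
    (hd : ∀ i ≤ n 0, heunRec m (-ε) (n 0) d i = (E - ε * m 1) * d i) :
    (fun j => d (m 1 - j)) ∈ blockSolutions m ε (n 1) E := fun i hi hi' => by
  rw [heunRec_reverse hnm ε d (by omega), hd _ (by omega)]
  ring

theorem dual_mem_blockSolutions (hnm : n 0 + n 1 = m 0 + m 1)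
    (he : ∀ i ≤ m 1, heunRec n ε (m 1) e i = E * e i) : e ∈ blockSolutions m ε (n 1) E :=
  fun i _ hi => heunRec_dual hnm ε ▸ he i (by omega)

theorem betheSum_pow_mul_mem_span (hx : ∀ i ∈ Finset.Icc (k - m 0) (min (m 1) k),
      c i = c (k - m 0) * x i) :
    betheSum m k (fun i => σ ^ i * c i) ∈ ℂ ∙ betheSum m k (fun i => σ ^ i * x i) := by
  refine Submodule.mem_span_singleton.2 ⟨c (k - m 0), ?_⟩
  rw [← betheSum_smul]
  exact betheSum_congr fun i hi => by rw [hx i hi, mul_left_comm]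

theorem betheSum_pow_mul_eq_weylIso (hnm : n 0 + n 1 = m 0 + m 1) (hσ : σ * σ = 1)
    (d : ℕ → ℂ) : betheSum m (n 0) (fun i => σ ^ i * d i) =
      σ ^ m 1 • weylIso (betheSum m (n 1) fun i => σ ^ i * d (m 1 - i)) := by
  rw [weylIso_betheSum hnm, ← betheSum_smul]
  refine betheSum_congr fun i hi => ?_
  obtain ⟨j, hj⟩ := Nat.exists_eq_add_of_le ((Finset.mem_Icc.1 hi).2.trans (min_le_left _ _))
  have hsign : σ ^ (i + j) * σ ^ j = σ ^ i := by
    rw [pow_add, mul_assoc, ← mul_pow, hσ, one_pow, mul_one]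
  rw [hj, Nat.add_sub_cancel_left, Nat.add_sub_cancel, ← mul_assoc, hsign]

theorem exists_betheSum_mem_span (hnm : n 0 + n 1 = m 0 + m 1) (hl : l 0 ≠ l 1) (hz : z 0 ≠ z 1)
    (hc : heunOp z m (l 1 - l 0) (n 1) (twoPointPoly z (n 1) c) = E • twoPointPoly z (n 1) c)
    (hd : heunOp z m (l 0 - l 1) (n 0) (twoPointPoly z (n 0) d) =
      (E - (l 1 - l 0) * m 1 * (z 1 - z 0)) • twoPointPoly z (n 0) d)
    (he : heunOp l n (z 1 - z 0) (m 1) (twoPointPoly l (m 1) e) = E • twoPointPoly l (m 1) e) :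
    ∃ x : ℕ → ℂ, x (n 1 - m 0) = 1 ∧ ∀ σ : ℂ, σ * σ = 1 →
      betheSum m (n 1) (fun i => σ ^ i * c i) ∈ ℂ ∙ betheSum m (n 1) (fun i => σ ^ i * x i) ∧
      betheSum m (n 0) (fun i => σ ^ i * d i) ∈
        ℂ ∙ weylIso (betheSum m (n 1) fun i => σ ^ i * x i) ∧
      dualityIso (betheSum n (m 1) fun i => σ ^ i * e i) ∈
        ℂ ∙ betheSum m (n 1) (fun i => σ ^ i * x i) := by
  rw [heunOp_twoPointPoly_eq_smul_iff hz] at hc hd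
  rw [heunOp_twoPointPoly_eq_smul_iff hl, mul_comm (z 1 - z 0)] at he
  rw [show (l 0 - l 1) * (z 1 - z 0) = -((l 1 - l 0) * (z 1 - z 0)) by ring,
    mul_right_comm] at hd
  obtain ⟨x, hx₀, hx⟩ := exists_blockSolutions_eq_smul m ((l 1 - l 0) * (z 1 - z 0)) (n 1) E
  refine ⟨x, hx₀, fun σ hσ => ⟨?_, ?_, ?_⟩⟩
  · exact betheSum_pow_mul_mem_span (hx c fun i _ hi => hc i (by omega))
  · rw [betheSum_pow_mul_eq_weylIso hnm hσ]
    exact Submodule.smul_mem _ _ (apply_mem_span_singleton weylIso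
      (betheSum_pow_mul_mem_span (hx _ (reverse_mem_blockSolutions hnm hd))))
  · rw [dualityIso_betheSum hnm]
    exact Submodule.smul_mem _ _
      (betheSum_pow_mul_mem_span (hx e (dual_mem_blockSolutions hnm he)))

theorem exists_betheSum_eq_smul (hnm : n 0 + n 1 = m 0 + m 1) (hl : l 0 ≠ l 1) (hz : z 0 ≠ z 1)
    (hc : heunOp z m (l 1 - l 0) (n 1) (twoPointPoly z (n 1) c) = E • twoPointPoly z (n 1) c)
    (hd : heunOp z m (l 0 - l 1) (n 0) (twoPointPoly z (n 0) d) =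
      (E - (l 1 - l 0) * m 1 * (z 1 - z 0)) • twoPointPoly z (n 0) d)
    (he : heunOp l n (z 1 - z 0) (m 1) (twoPointPoly l (m 1) e) = E • twoPointPoly l (m 1) e) :
    ∃ w ∈ weightSpace m n, w ≠ 0 ∧ ∃ κ₁ κ₂ κ₃ : ℂ,
      betheSum m (n 1) c = κ₁ • w ∧
      betheSum m (n 0) d = κ₂ • weylIso w ∧
      dualityIso (betheSum n (m 1) e) = κ₃ • w ∧
      ((∀ a, (twoPointPoly z (n 1) c).eval (z a) ≠ 0) → κ₁ ≠ 0) ∧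
      ((∀ a, (twoPointPoly z (n 0) d).eval (z a) ≠ 0) → κ₂ ≠ 0) ∧
      ((∀ i, (twoPointPoly l (m 1) e).eval (l i) ≠ 0) → κ₃ ≠ 0) := by
  obtain ⟨x, hx, hline⟩ := exists_betheSum_mem_span hnm hl hz hc hd he
  obtain ⟨⟨κ₁, hκ₁⟩, ⟨κ₂, hκ₂⟩, ⟨κ₃, hκ₃⟩⟩ := by
    simpa only [one_pow, one_mul, Submodule.mem_span_singleton] using hline 1 (one_mul 1)
  have hw : betheSum m (n 1) x ≠ 0 :=
    betheSum_ne_zero_of_coeff_ne_zero (by omega) (hx ▸ one_ne_zero)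
  refine ⟨betheSum m (n 1) x, betheSum_mem_weightSpace hnm x, hw, κ₁, κ₂, κ₃, hκ₁.symm, hκ₂.symm,
    hκ₃.symm, fun hne => ?_, fun hne => ?_, fun hne => ?_⟩
  · exact left_ne_zero_of_smul (hκ₁ ▸ betheSum_ne_zero_of_coeff_ne_zero (by omega)
      (coeff_ne_zero_of_eval_ne_zero hz (sub_ne_zero.2 hl.symm) hc hne))
  · exact left_ne_zero_of_smul (hκ₂ ▸ betheSum_ne_zero_of_coeff_ne_zero (by omega)
      (coeff_ne_zero_of_eval_ne_zero hz (sub_ne_zero.2 hl) hd hne))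
  · exact left_ne_zero_of_smul (hκ₃ ▸ dualityIso.map_ne_zero_iff.2
      (betheSum_ne_zero_of_coeff_ne_zero (by omega)
        (coeff_ne_zero_of_eval_ne_zero hl (sub_ne_zero.2 hz.symm) he hne)))

theorem exists_universalVector_mem_span (hnm : n 0 + n 1 = m 0 + m 1) (hl : l 0 ≠ l 1)
    (hz : z 0 ≠ z 1)
    (hc : heunOp z m (l 1 - l 0) (n 1) (twoPointPoly z (n 1) c) = E • twoPointPoly z (n 1) c)
    (hd : heunOp z m (l 0 - l 1) (n 0) (twoPointPoly z (n 0) d) =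
      (E - (l 1 - l 0) * m 1 * (z 1 - z 0)) • twoPointPoly z (n 0) d)
    (he : heunOp l n (z 1 - z 0) (m 1) (twoPointPoly l (m 1) e) = E • twoPointPoly l (m 1) e) :
    ∃ v : Pol ⊗[ℂ] Pol,
      (∀ t : Fin (n 1) → ℂ, Represents (twoPointPoly z (n 1) c) t → IsAdmissible z t →
        universalVector z m t ∈ ℂ ∙ v) ∧
      (∀ s : Fin (n 0) → ℂ, Represents (twoPointPoly z (n 0) d) s → IsAdmissible z s →
        universalVector z m s ∈ ℂ ∙ weylIso v) ∧
      (∀ r : Fin (m 1) → ℂ, Represents (twoPointPoly l (m 1) e) r → IsAdmissible l r →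
        dualityIso (universalVector l n r) ∈ ℂ ∙ v) := by
  obtain ⟨x, -, hline⟩ := exists_betheSum_mem_span hnm hl hz hc hd he
  obtain ⟨hct, hds, her⟩ := hline (-1) (by norm_num)
  refine ⟨betheSum m (n 1) fun i => (-1) ^ i * x i, fun t ht ht' => ?_, fun s hs hs' => ?_,
    fun r hr hr' => ?_⟩
  · exact Submodule.mem_span_singleton_trans (universalVector_mem_span m hz ht ht') hct
  · exact Submodule.mem_span_singleton_trans (universalVector_mem_span m hz hs hs') hds
  · exact Submodule.mem_span_singleton_trans
      (apply_mem_span_singleton dualityIso (universalVector_mem_span n hl hr hr')) her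

end CommonLine

theorem corollary6p4
    (l z : Fin 2 → ℂ) (n m : Fin 2 → ℕ) (hnm : n 0 + n 1 = m 0 + m 1)
    (p q : Fin 2 → ℂ[X]) (V U : Submodule ℂ (ℂ → ℂ))
    (hp : ∀ i, (p i).degree = (n i : WithBot ℕ)) (hVp : V = quasiSpace l p)
    (hV : IsSpecialSpace l z n m V)
    (hU : U = specialDual 2 z V)
    (hq : ∀ a, (q a).degree = (m a : WithBot ℕ)) (hUq : U = quasiSpace z q)
    (c d e : ℕ → ℂ)
    (hc : p 1 = twoPointPoly z (n 1) c)
    (hd : p 0 = twoPointPoly z (n 0) d)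
    (he : q 1 = twoPointPoly l (m 1) e) :
    -- the Weyl and duality isomorphisms relate the three weight subspaces
    ((weightSpace m n).map weylIso.toLinearMap = weightSpace m (swapPair n) ∧
      (weightSpace n m).map dualityIso.toLinearMap = weightSpace m n) ∧
    -- the three vectors lie in them
    (betheSum m (n 1) c ∈ weightSpace m n ∧
      betheSum m (n 0) d ∈ weightSpace m (swapPair n) ∧
      betheSum n (m 1) e ∈ weightSpace n m) ∧
    -- after identification they lie on a common line, and are nonzero in the admissible case
    (∃ w ∈ weightSpace m n, w ≠ 0 ∧ ∃ κ₁ κ₂ κ₃ : ℂ,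
      betheSum m (n 1) c = κ₁ • w ∧
      betheSum m (n 0) d = κ₂ • weylIso w ∧
      dualityIso (betheSum n (m 1) e) = κ₃ • w ∧
      ((∀ a, (p 1).eval (z a) ≠ 0) → κ₁ ≠ 0) ∧
      ((∀ a, (p 0).eval (z a) ≠ 0) → κ₂ ≠ 0) ∧
      ((∀ i, (q 1).eval (l i) ≠ 0) → κ₃ ≠ 0)) ∧
    -- admissible root tuples are critical points, and their universal vectors are proportional to
    -- the vectors above with the signs `(-1)^i` inserted in the coefficients
    (∀ t : Fin (n 1) → ℂ, Represents (p 1) t → IsAdmissible z t →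
      IsCriticalPoint l z m t ∧ universalVector z m t ≠ 0 ∧
      ∃ κ : ℂ, κ ≠ 0 ∧ universalVector z m t = κ • betheSum m (n 1) (fun i => (-1) ^ i * c i)) ∧
    (∀ s : Fin (n 0) → ℂ, Represents (p 0) s → IsAdmissible z s →
      IsCriticalPoint (swapPair l) z m s ∧ universalVector z m s ≠ 0 ∧
      ∃ κ : ℂ, κ ≠ 0 ∧ universalVector z m s = κ • betheSum m (n 0) (fun i => (-1) ^ i * d i)) ∧
    (∀ r : Fin (m 1) → ℂ, Represents (q 1) r → IsAdmissible l r →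
      IsCriticalPoint z l n r ∧ universalVector l n r ≠ 0 ∧
      ∃ κ : ℂ, κ ≠ 0 ∧ universalVector l n r = κ • betheSum n (m 1) (fun i => (-1) ^ i * e i)) ∧
    -- the Bethe vectors are identified up to proportionality
    (∀ (t : Fin (n 1) → ℂ) (s : Fin (n 0) → ℂ), Represents (p 1) t → IsAdmissible z t →
      Represents (p 0) s → IsAdmissible z s →
      ∃ κ : ℂ, κ ≠ 0 ∧ weylIso (universalVector z m t) = κ • universalVector z m s) ∧
    (∀ (t : Fin (n 1) → ℂ) (r : Fin (m 1) → ℂ), Represents (p 1) t → IsAdmissible z t →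
      Represents (q 1) r → IsAdmissible l r →
      ∃ κ : ℂ, κ ≠ 0 ∧ dualityIso (universalVector l n r) = κ • universalVector z m t) := by
  subst hVp hU
  have hl : l 0 ≠ l 1 := hV.l_injective.ne zero_ne_one
  have hz : z 0 ≠ z 1 := hV.z_injective.ne zero_ne_one
  have hq₁ : quasiPoly (q 1) (z 1) ∈ specialDual 2 z (quasiSpace l p) :=
    hUq ▸ Submodule.subset_span ⟨1, rfl⟩
  obtain ⟨E, h₁, h₀, h₂⟩ := exists_heunOp_eq_smul_of_specialDual hnm hp hV hq₁
  rw [hc] at h₁ ⊢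
  rw [hd] at h₀ ⊢
  rw [he] at h₂ ⊢
  obtain ⟨v, hvt, hvs, hvr⟩ := exists_universalVector_mem_span hnm hl hz h₁ h₀ h₂
  have hBt := fun t => isCriticalPoint_and_universalVector (t := t) hl hz (by omega) h₁
  have hBs := fun s => isCriticalPoint_and_universalVector (l := swapPair l) (t := s) hl.symm hz
    (by omega) h₀
  have hBr := fun r => isCriticalPoint_and_universalVector (t := r) hz hl (by omega) h₂
  refine ⟨⟨map_weylIso_weightSpace m n, map_dualityIso_weightSpace m n⟩,
    ⟨betheSum_mem_weightSpace hnm c,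
      betheSum_mem_weightSpace (n := swapPair n) ((add_comm _ _).trans hnm) d,
      betheSum_mem_weightSpace hnm.symm e⟩,
    exists_betheSum_eq_smul hnm hl hz h₁ h₀ h₂, hBt, hBs, hBr,
    fun t s ht ht' hs hs' => ?_, fun t r ht ht' hr hr' => ?_⟩
  · exact exists_eq_smul_of_mem_span_singleton (apply_mem_span_singleton weylIso (hvt t ht ht'))
      (hvs s hs hs') (weylIso.map_ne_zero_iff.2 (hBt t ht ht').2.1) (hBs s hs hs').2.1
  · exact exists_eq_smul_of_mem_span_singleton (hvr r hr hr') (hvt t ht ht')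
      (dualityIso.map_ne_zero_iff.2 (hBr r hr hr').2.1) (hBt t ht ht').2.1
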